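/- Let $m\ge 2$ be an integer and let $g:[0,2\pi]\to\mathbb{R}$ be continuous, strictly concave, three times continuously differentiable in a neighborhood of each of the points $\frac{2\pi s}{m}$, $s=1,\dots,m-1$, and such that $g(x)=g(2\pi-x)$ for all $x\in[0,2\pi]$. Let $G=(g_{i,j})_{i,j=1}^{m-1}$ be the symmetric matrix with $$g_{i,j}=-g''\left(\frac{2\pi|i-j|}{m}\right)\ (i\ne j),\qquad g_{i,i}=\sum_{s=1}^{m-1}g''\left(\frac{2\pi s}{m}\right),$$ and suppose that $\det G\neq 0$. Let $U_1,U_2,\dots$ be independent random points on the unit circle $S^1\subset\mathbb{R}^2$ with center $O$, with a common continuous density $p$ with respect to arc length; $p$ is regarded as a continuous nonnegative $2\pi$-periodic function of the polar angle with $\int_0^{2\pi}p(x)\,dx=1$. Suppose that $$\int_0^{2\pi}\prod_{l=0}^{m-1}p\left(x+\frac{2\pi l}{m}\right)dx>0 .$$ For $u_1,\dots,u_m\in S^1$ let $\beta_i\in[0,2\pi)$ be the counterclockwise angle from $Ou_1$ to $Ou_{i+1}$, $0\le i\le m-1$ (so $\beta_0=0$), put $$f(u_1,\dots,u_m)=\sum_{0\le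 i<j\le m-1}g(|\beta_j-\beta_i|),$$ and, for $n\ge m$, let $H_n=\max_{1\le i_1<\dots<i_m\le n}f(U_{i_1},\dots,U_{i_m})$. Then for every $t>0$ $$\lim_{n\to\infty}\mathbb{P}\left\{n^{\frac{2m}{m-1}}\left(\frac12\sum_{s=1}^{m-1}m\,g\left(\frac{2\pi s}{m}\right)-H_n\right)\le t\right\}=1-\exp\left(-\frac{t^{\frac{m-1}{2}}K}{m}\right),$$ where $$K=\frac{(2\pi)^{\frac{m-1}{2}}\int_0^{2\pi}\prod_{l=0}^{m-1}p\left(x+\frac{2\pi l}{m}\right)dx}{\sqrt{\det(-G)}\;\Gamma\left(\frac{m+1}{2}\right)} .$$ -/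

import Mathlib

open Real Set Filter Topology MeasureTheory ProbabilityTheory

noncomputable section

namespace UMax

/-- The unit circle carries its Borel σ-algebra. -/
instance : MeasurableSpace Circle := borel Circle

instance : BorelSpace Circle := ⟨rfl⟩

/-- `p` is (the `2π`-periodic version of) a continuous probability density on the unit circle,
taken with respect to arc length and written as a function of the polar angle. -/
structure IsContinuousCircleDensity (p : ℝ → ℝ) : Prop where
  continuous : Continuous p
  periodic : Function.Periodic p (2 * π)
  nonneg : ∀ x, 0 ≤ p x
  integral_eq_one : ∫ x in (0 : ℝ)..(2 * π), p x = 1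

/-- The measure on the unit circle with density `p` with respect to arc length:
the image of `p x dx` on `[0, 2π)` under `x ↦ exp (i x)`. -/
def circleLaw (p : ℝ → ℝ) : Measure Circle :=
  ((volume.restrict (Ico (0 : ℝ) (2 * π))).withDensity
    (fun x => ENNReal.ofReal (p x))).map (fun x : ℝ => Circle.exp x)

/-- The angle from the vector `Oz` to the vector `Ow`, counterclockwise, in `[0, 2π)`. -/
def centralAngle (z w : Circle) : ℝ :=
  toIcoMod two_pi_pos 0 (Complex.arg ((w / z : Circle) : ℂ))

/-- The angles `β_i`, `0 ≤ i ≤ m - 1`, of the points `u 0, …, u (m - 1)`, measured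
from `u 0`; in particular `β_0 = 0`. -/
def angleFromFirst {m : ℕ} (u : Fin m → Circle) (i : Fin m) : ℝ :=
  centralAngle (u ⟨0, i.pos⟩) (u i)

/-- The kernel `∑_{0 ≤ i < j ≤ m - 1} g (|β_j - β_i|)`. -/
def pairKernel (g : ℝ → ℝ) {m : ℕ} (u : Fin m → Circle) : ℝ :=
  ∑ i : Fin m, ∑ j ∈ Finset.Ioi i, g |angleFromFirst u j - angleFromFirst u i|

/-- The `U`-max statistic of the kernel `f` of degree `m` on the sample `x 0, …, x (n - 1)`:
the maximum of `f (x i_1, …, x i_m)` over all `i_1 < ⋯ < i_m`. It is the maximum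
of a finite nonempty family as soon as `m ≤ n`. -/
def uMax {X : Type*} {m : ℕ} (f : (Fin m → X) → ℝ) (n : ℕ) (x : ℕ → X) : ℝ :=
  ⨆ J : Fin m ↪o Fin n, f (fun l => x (J l))

/-- The symmetric `(m - 1) × (m - 1)` matrix `G` with entries `-g''(2π|i - j|/m)` off the
diagonal and `∑_{s=1}^{m-1} g''(2πs/m)` on the diagonal. -/
def matrixG (g : ℝ → ℝ) (m : ℕ) : Matrix (Fin (m - 1)) (Fin (m - 1)) ℝ :=
  Matrix.of fun i j =>
    if i = j then ∑ s ∈ Finset.Icc 1 (m - 1), iteratedDeriv 2 g (2 * π * (s : ℝ) / (m : ℝ))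
    else -iteratedDeriv 2 g (2 * π * |((i : ℕ) : ℝ) - ((j : ℕ) : ℝ)| / (m : ℝ))

/-- The maximal value `(1/2) ∑_{s=1}^{m-1} m g(2πs/m)` of the kernel. -/
def maxValue (g : ℝ → ℝ) (m : ℕ) : ℝ :=
  (1 / 2) * ∑ s ∈ Finset.Icc 1 (m - 1), (m : ℝ) * g (2 * π * (s : ℝ) / (m : ℝ))

/-- The integral `∫_0^{2π} ∏_{l=0}^{m-1} p (x + 2πl/m) dx`. -/
def densityIntegral (p : ℝ → ℝ) (m : ℕ) : ℝ :=
  ∫ x in (0 : ℝ)..(2 * π), ∏ l ∈ Finset.range m, p (x + 2 * π * (l : ℝ) / (m : ℝ))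

/-- The constant
`K = (2π)^((m-1)/2) ∫_0^{2π} ∏_l p (x + 2πl/m) dx / (√(det (-G)) Γ((m+1)/2))`. -/
def constK (g p : ℝ → ℝ) (m : ℕ) : ℝ :=
  ((2 * π) ^ (((m : ℝ) - 1) / 2) * densityIntegral p m) /
    (√((-matrixG g m).det) * Real.Gamma (((m : ℝ) + 1) / 2))

end UMax

end

/-! Write m = k + 1 and call `maxValue` minus the kernel the deficit of a tuple. Since H_n is a
maximum, the event in question says that some m-subset of the first n points has deficit at most s²,
where s = √t n^(-m/k). The number of such subsets is asymptotically Poisson, so the limit is 1 -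
exp(-λ) with λ the limit of its expectation. Two ingredients are needed.

Expectation. Angles are measured from the first point, which leaves k coordinates. The regular
polygon is a critical point because g' is odd about π, and there the deficit is half the quadratic
form of -G up to a smaller error (`eventually_pairSum_taylor`, `quadForm_cons`). Concavity makes -G
positive semidefinite, det G ≠ 0 makes it definite, and concavity of `pairSum` on ordered
configurations turns local growth into global quadratic growth (`exists_growth`). After rescaling by
s, the set of small deficits on ordered angles becomes the ellipsoid {y·(-G)y < 2}; dominated
convergence and the k! orderings give a probability asymptotic to k! K s^k
(`tendsto_deficit_probability`). Multiplying by binom(n, m) gives t^(k/2) K / m.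

Dependence. `abs_prob_sum_eq_zero_sub_exp_le` reduces the Poisson limit to overlapping pairs J, K of
index sets. If both have small deficit, every point of J ∪ K lies, as seen from a common point,
within O(s) of a multiple of 2π/m. This has probability at most (C s)^(|J ∪ K| - 1), and the total
error O(n (n s)^m) is of order n^(-1/k) (`abs_prob_sub_exp_le`, `tendsto_overlap_error`). -/

namespace UMax

/-! ### Poisson approximation for locally dependent indicators -/

section Poisson

variable {Ω : Type*} [MeasurableSpace Ω] {μ : Measure Ω} [IsProbabilityMeasure μ]

theorem integrable_of_nonneg_of_le_one {f : Ω → ℝ} (hf : Measurable f) (h0 : ∀ ω, 0 ≤ f ω)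
    (h1 : ∀ ω, f ω ≤ 1) : Integrable f μ :=
  Integrable.of_bound hf.aestronglyMeasurable 1 (Eventually.of_forall fun ω => by
    rw [Real.norm_eq_abs, abs_of_nonneg (h0 ω)]; exact h1 ω)

/-- The generating function of a bounded `ℕ`-valued random variable can be differentiated under
the expectation. -/
theorem hasDerivAt_integral_pow {W : Ω → ℕ} (hW : Measurable W) {N : ℕ} (hN : ∀ ω, W ω ≤ N)
    (s : ℝ) : HasDerivAt (fun s => ∫ ω, s ^ W ω ∂μ) (∫ ω, (W ω : ℝ) * s ^ (W ω - 1) ∂μ) s := by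
  have key : ∀ h : ℕ → ℝ, ∫ ω, h (W ω) ∂μ =
      ∑ k ∈ Finset.range (N + 1), μ.real (W ⁻¹' {k}) * h k := by
    intro h
    have : ∀ ω, h (W ω) = ∑ k ∈ Finset.range (N + 1), (W ⁻¹' {k}).indicator (fun _ => h k) ω := by
      intro ω
      rw [Finset.sum_eq_single (W ω)]
      · simp
      · intro b _ hb
        exact indicator_of_notMem (fun h => hb h.symm) _
      · intro h
        exact absurd (Finset.mem_range.2 (Nat.lt_succ_of_le (hN ω))) h
    simp_rw [this]
    rw [integral_finsetSum]
    · refine Finset.sum_congr rfl fun k _ => ?_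
      rw [integral_indicator_const _ (hW (measurableSet_singleton k)), smul_eq_mul]
    · intro k _
      exact (integrable_const _).indicator (hW (measurableSet_singleton k))
  have e1 : (fun s : ℝ => ∫ ω, s ^ W ω ∂μ) =
      fun s => ∑ k ∈ Finset.range (N + 1), μ.real (W ⁻¹' {k}) * s ^ k :=
    funext fun s => key fun k => s ^ k
  rw [e1, key fun k => (k : ℝ) * s ^ (k - 1)]
  exact HasDerivAt.fun_sum fun k _ => (hasDerivAt_pow k s).const_mul _

/-- **Poisson approximation** of the probability that none of a finite family of
locally dependent events occurs. -/
theorem abs_prob_sum_eq_zero_sub_exp_le {ι : Type*} [DecidableEq ι] (T : Finset ι)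
    (N : ι → Finset ι) (hNT : ∀ j ∈ T, N j ⊆ T) (hN : ∀ j ∈ T, j ∈ N j)
    (X : ι → Ω → ℕ) (hX : ∀ j, Measurable (X j)) (hX1 : ∀ j ω, X j ω ≤ 1)
    (hind : ∀ j ∈ T, IndepFun (X j) (fun ω => ∑ k ∈ T \ N j, X k ω) μ) :
    |μ.real {ω | ∑ j ∈ T, X j ω = 0} - exp (-∑ j ∈ T, ∫ ω, (X j ω : ℝ) ∂μ)| ≤
      ∑ j ∈ T, (∑ k ∈ N j, (∫ ω, (X j ω : ℝ) ∂μ) * (∫ ω, (X k ω : ℝ) ∂μ) +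
        ∑ k ∈ (N j).erase j, ∫ ω, (X j ω : ℝ) * X k ω ∂μ) := by
  classical
  set W : Ω → ℕ := fun ω => ∑ j ∈ T, X j ω with hWdef
  have hXR : ∀ j, Measurable fun ω => (X j ω : ℝ) := fun j =>
    (measurable_from_top (f := fun n : ℕ => (n : ℝ))).comp (hX j)
  have hX1R : ∀ j ω, (X j ω : ℝ) ≤ 1 := fun j ω => by exact_mod_cast hX1 j ω
  have hXint : ∀ j, Integrable (fun ω => (X j ω : ℝ)) μ := fun j =>
    integrable_of_nonneg_of_le_one (hXR j) (fun ω => Nat.cast_nonneg _) (hX1R j)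
  have hXXint : ∀ j k, Integrable (fun ω => (X j ω : ℝ) * X k ω) μ := fun j k =>
    integrable_of_nonneg_of_le_one ((hXR j).mul (hXR k)) (fun ω => by positivity)
      (fun ω => mul_le_one₀ (hX1R j ω) (Nat.cast_nonneg _) (hX1R k ω))
  have hsumm : ∀ S : Finset ι, Measurable fun ω => ∑ k ∈ S, X k ω := fun S =>
    Finset.measurable_sum S fun k _ => hX k
  have hWm : Measurable W := hsumm T
  have hWN : ∀ ω, W ω ≤ T.card := fun ω => by
    simpa using Finset.sum_le_card_nsmul T (fun j => X j ω) 1 fun j _ => hX1 j ω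
  set p : ι → ℝ := fun j => ∫ ω, (X j ω : ℝ) ∂μ with hp
  have hp0 : ∀ j, 0 ≤ p j := fun j => integral_nonneg fun ω => Nat.cast_nonneg _
  set lam := ∑ j ∈ T, p j with hlam
  have hlam0 : 0 ≤ lam := Finset.sum_nonneg fun j _ => hp0 j
  set B := ∑ j ∈ T, (∑ k ∈ N j, p j * p k + ∑ k ∈ (N j).erase j, ∫ ω, (X j ω : ℝ) * X k ω ∂μ)
    with hB
  have hpowm : ∀ (s : ℝ) {V : Ω → ℕ}, Measurable V → Measurable fun ω => s ^ V ω := fun s V hV =>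
    (measurable_from_top (f := fun n : ℕ => s ^ n)).comp hV
  have hpowi : ∀ (s : ℝ) {V : Ω → ℕ}, Measurable V → 0 ≤ s → s ≤ 1 →
      Integrable (fun ω => s ^ V ω) μ := fun s V hV h0 h1 =>
    integrable_of_nonneg_of_le_one (hpowm s hV) (fun ω => by positivity)
      (fun ω => pow_le_one₀ h0 h1)
  have hone : ∀ (s : ℝ) (n : ℕ), 0 ≤ s → s ≤ 1 → 1 - s ^ n ≤ n := by
    intro s n h0 h1
    rcases Nat.eq_zero_or_pos n with rfl | hn
    · simp
    · have : (1 : ℝ) ≤ n := by exact_mod_cast hn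
      have := pow_nonneg h0 n
      linarith
  -- The generating function φ(s) = E s^W of a Poisson variable solves φ' = λφ; here the equation
  -- holds on [0, 1] up to the error B.
  have hmain : ∀ s : ℝ, 0 ≤ s → s ≤ 1 →
      |∫ ω, (W ω : ℝ) * s ^ (W ω - 1) ∂μ - lam * ∫ ω, s ^ W ω ∂μ| ≤ B := by
    intro s h0 h1
    have hXpi : ∀ (j : ι) {V : Ω → ℕ}, Measurable V →
        Integrable (fun ω => (X j ω : ℝ) * s ^ V ω) μ := fun j V hV =>
      integrable_of_nonneg_of_le_one ((hXR j).mul (hpowm s hV)) (fun ω => by positivity)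
        (fun ω => mul_le_one₀ (hX1R j ω) (by positivity) (pow_le_one₀ h0 h1))
    have e1 : ∫ ω, (W ω : ℝ) * s ^ (W ω - 1) ∂μ = ∑ j ∈ T, ∫ ω, (X j ω : ℝ) * s ^ (W ω - 1) ∂μ := by
      rw [← integral_finsetSum _ fun j _ => hXpi j (hWm.sub_const 1)]
      refine integral_congr_ae (Eventually.of_forall fun ω => ?_)
      simp only [hWdef]
      rw [← Finset.sum_mul]
      push_cast
      rfl
    rw [e1, hlam, Finset.sum_mul, ← Finset.sum_sub_distrib]
    refine (Finset.abs_sum_le_sum_abs _ _).trans (Finset.sum_le_sum fun j hj => ?_)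
    -- Z is independent of X j, and Y collects the other neighbours of j. Dropping Y from the
    -- exponent costs the mixed moments E X_j X_k; after factoring, returning from Z to W costs p_j
    -- ∑ p_k over N j.
    set Z : Ω → ℕ := fun ω => ∑ k ∈ T \ N j, X k ω with hZ
    set Y : Ω → ℕ := fun ω => ∑ k ∈ (N j).erase j, X k ω with hY
    have hWsplit : ∀ ω, W ω = X j ω + Y ω + Z ω := by
      intro ω
      simp only [hWdef, hY, hZ]
      rw [Finset.add_sum_erase _ (fun k => X k ω) (hN j hj), add_comm,
        Finset.sum_sdiff (hNT j hj)]
    have hZm : Measurable Z := hsumm _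
    have hYm : Measurable Y := hsumm _
    have hfac : ∫ ω, (X j ω : ℝ) * s ^ Z ω ∂μ = p j * ∫ ω, s ^ Z ω ∂μ := by
      have := (hind j hj).comp (φ := fun n : ℕ => (n : ℝ)) (ψ := fun n : ℕ => s ^ n)
        measurable_from_top measurable_from_top
      exact this.integral_fun_mul_eq_mul_integral (hXR j).aestronglyMeasurable
        (hpowm s hZm).aestronglyMeasurable
    -- The truncated subtraction is harmless: the factor X j vanishes unless X j = 1, and then W - 1
    -- = Y + Z.
    have hXW : ∫ ω, (X j ω : ℝ) * s ^ (W ω - 1) ∂μ = ∫ ω, (X j ω : ℝ) * s ^ (Y ω + Z ω) ∂μ := by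
      refine integral_congr_ae (Eventually.of_forall fun ω => ?_)
      have := hX1 j ω
      have h2 : X j ω = 0 ∨ X j ω = 1 := by omega
      simp only [hWsplit]
      rcases h2 with h2 | h2
      · simp [h2]
      · rw [h2, show 1 + Y ω + Z ω - 1 = Y ω + Z ω by omega]
    have ha : |∫ ω, (X j ω : ℝ) * s ^ (Y ω + Z ω) ∂μ - ∫ ω, (X j ω : ℝ) * s ^ Z ω ∂μ| ≤
        ∑ k ∈ (N j).erase j, ∫ ω, (X j ω : ℝ) * X k ω ∂μ := by
      have hYZ : Integrable (fun ω => (X j ω : ℝ) * s ^ (Y ω + Z ω)) μ := hXpi j (hYm.add hZm)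
      rw [← integral_sub hYZ (hXpi j hZm), ← integral_finsetSum _ fun k _ => hXXint j k]
      refine abs_integral_le_integral_abs.trans (integral_mono
        (hYZ.sub (hXpi j hZm)).abs
        (integrable_finsetSum _ fun k _ => hXXint j k) fun ω => ?_)
      have hz1 : s ^ Z ω ≤ 1 := pow_le_one₀ h0 h1
      have hz0 : 0 ≤ s ^ Z ω := by positivity
      have hy1 : s ^ Y ω ≤ 1 := pow_le_one₀ h0 h1
      have hx0 : (0 : ℝ) ≤ X j ω := Nat.cast_nonneg _
      have : (X j ω : ℝ) * s ^ (Y ω + Z ω) - X j ω * s ^ Z ω =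
          -(X j ω * ((1 - s ^ Y ω) * s ^ Z ω)) := by ring
      beta_reduce
      rw [this, abs_neg, abs_of_nonneg (mul_nonneg hx0 (mul_nonneg (by linarith) hz0)),
        ← Finset.mul_sum]
      refine mul_le_mul_of_nonneg_left ?_ hx0
      calc (1 - s ^ Y ω) * s ^ Z ω ≤ (1 - s ^ Y ω) * 1 :=
            mul_le_mul_of_nonneg_left hz1 (by linarith)
        _ ≤ Y ω := by rw [mul_one]; exact hone s _ h0 h1
        _ = ∑ k ∈ (N j).erase j, (X k ω : ℝ) := by simp [hY]
    have hb : |∫ ω, s ^ Z ω ∂μ - ∫ ω, s ^ W ω ∂μ| ≤ ∑ k ∈ N j, p k := by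
      rw [← integral_sub (hpowi s hZm h0 h1) (hpowi s hWm h0 h1), hp,
        ← integral_finsetSum _ fun k _ => hXint k]
      refine abs_integral_le_integral_abs.trans (integral_mono
        ((hpowi s hZm h0 h1).sub (hpowi s hWm h0 h1)).abs
        (integrable_finsetSum _ fun k _ => hXint k) fun ω => ?_)
      have hz1 : s ^ Z ω ≤ 1 := pow_le_one₀ h0 h1
      have hz0 : 0 ≤ s ^ Z ω := by positivity
      have hy1 : s ^ (X j ω + Y ω) ≤ 1 := pow_le_one₀ h0 h1
      have : s ^ Z ω - s ^ W ω = (1 - s ^ (X j ω + Y ω)) * s ^ Z ω := by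
        rw [hWsplit]; ring
      beta_reduce
      rw [this, abs_of_nonneg (mul_nonneg (by linarith) hz0)]
      calc (1 - s ^ (X j ω + Y ω)) * s ^ Z ω ≤ (1 - s ^ (X j ω + Y ω)) * 1 :=
            mul_le_mul_of_nonneg_left hz1 (by linarith)
        _ ≤ (X j ω + Y ω : ℕ) := by rw [mul_one]; exact hone s _ h0 h1
        _ = ∑ k ∈ N j, (X k ω : ℝ) := by
          rw [← Finset.add_sum_erase _ (fun k => (X k ω : ℝ)) (hN j hj)]
          simp [hY]
    calc |∫ ω, (X j ω : ℝ) * s ^ (W ω - 1) ∂μ - p j * ∫ ω, s ^ W ω ∂μ|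
        = |(∫ ω, (X j ω : ℝ) * s ^ (Y ω + Z ω) ∂μ - ∫ ω, (X j ω : ℝ) * s ^ Z ω ∂μ) +
          p j * (∫ ω, s ^ Z ω ∂μ - ∫ ω, s ^ W ω ∂μ)| := by
          rw [hXW, hfac]; congr 1; ring
      _ ≤ _ := (abs_add_le _ _).trans (add_le_add ha le_rfl)
      _ ≤ _ := by
        rw [abs_mul, abs_of_nonneg (hp0 j), add_comm]
        refine add_le_add ?_ le_rfl
        rw [← Finset.mul_sum]
        exact mul_le_mul_of_nonneg_left hb (hp0 j)
  -- With the integrating factor exp(-λs) the mean value inequality applies on [0, 1]: the value at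
  -- 1 is exp(-λ), the value at 0 is P(W = 0) because 0 ^ 0 = 1.
  have hder : ∀ s : ℝ, HasDerivAt (fun s => (∫ ω, s ^ W ω ∂μ) * exp (-(lam * s)))
      ((∫ ω, (W ω : ℝ) * s ^ (W ω - 1) ∂μ) * exp (-(lam * s)) +
        (∫ ω, s ^ W ω ∂μ) * (exp (-(lam * s)) * (-(lam * 1)))) s := fun s =>
    (hasDerivAt_integral_pow hWm hWN s).mul ((((hasDerivAt_id s).const_mul lam).neg).exp)
  have hmv := norm_image_sub_le_of_norm_deriv_le_segment_01'
    (f := fun s => (∫ ω, s ^ W ω ∂μ) * exp (-(lam * s))) (C := B)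
    (fun s _ => (hder s).hasDerivWithinAt) (fun s hs => by
      have e : (∫ ω, (W ω : ℝ) * s ^ (W ω - 1) ∂μ) * exp (-(lam * s)) +
          (∫ ω, s ^ W ω ∂μ) * (exp (-(lam * s)) * (-(lam * 1))) =
          (∫ ω, (W ω : ℝ) * s ^ (W ω - 1) ∂μ - lam * ∫ ω, s ^ W ω ∂μ) * exp (-(lam * s)) := by
        ring
      rw [e, Real.norm_eq_abs, abs_mul, abs_of_pos (exp_pos _)]
      calc _ ≤ |∫ ω, (W ω : ℝ) * s ^ (W ω - 1) ∂μ - lam * ∫ ω, s ^ W ω ∂μ| * 1 :=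
            mul_le_mul_of_nonneg_left (exp_le_one_iff.2 (by
              have := mul_nonneg hlam0 hs.1; linarith)) (abs_nonneg _)
        _ ≤ B := by rw [mul_one]; exact hmain s hs.1 hs.2.le)
  have hzero : ∫ ω, (0 : ℝ) ^ W ω ∂μ = μ.real {ω | ∑ j ∈ T, X j ω = 0} := by
    have hms : MeasurableSet {ω | W ω = 0} := hWm (measurableSet_singleton 0)
    rw [← integral_indicator_one hms]
    refine integral_congr_ae (Eventually.of_forall fun ω => ?_)
    by_cases h : W ω = 0
    · simp [h]
    · simp [h]
  simp only [one_pow, integral_const, probReal_univ, smul_eq_mul, mul_one, one_mul, mul_zero,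
    neg_zero, exp_zero, hzero, Real.norm_eq_abs] at hmv
  rwa [abs_sub_comm] at hmv

end Poisson

/-! ### Second-order expansion of the kernel at the regular polygon -/

section Kernel

/-- The sum of `g` over the absolute differences of all pairs of coordinates. -/
noncomputable def pairSum (g : ℝ → ℝ) {m : ℕ} (β : Fin m → ℝ) : ℝ :=
  ∑ i : Fin m, ∑ j ∈ Finset.Ioi i, g |β j - β i|

/-- The angles `2πi/m` of the vertices of a regular polygon. -/
noncomputable def regularAngles (m : ℕ) (i : Fin m) : ℝ := 2 * π * ((i : ℕ) : ℝ) / (m : ℝ)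

/-- The hypotheses on the function `g`. -/
structure IsAdmissible (g : ℝ → ℝ) (m : ℕ) : Prop where
  cont : ContinuousOn g (Icc 0 (2 * π))
  conc : ConcaveOn ℝ (Icc 0 (2 * π)) g
  smooth : ∀ s ∈ Finset.Icc 1 (m - 1), ContDiffAt ℝ 2 g (2 * π * (s : ℝ) / (m : ℝ))
  symm : ∀ x ∈ Icc 0 (2 * π), g x = g (2 * π - x)

theorem pairKernel_eq_pairSum (g : ℝ → ℝ) {m : ℕ} (u : Fin m → Circle) :
    pairKernel g u = pairSum g (angleFromFirst u) := rfl

theorem sum_Ioi_add_symm {m : ℕ} (f : Fin m → Fin m → ℝ) :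
    ∑ i, ∑ j ∈ Finset.Ioi i, (f j i + f i j) = ∑ i, ∑ j ∈ {i}ᶜ, f i j := by
  rw [← Finset.sum_sum_Ioi_add_eq_sum_sum_off_diag fun j i => f i j]
  refine Finset.sum_congr rfl fun i _ => Finset.sum_congr rfl fun j _ => add_comm _ _

theorem two_mul_pairSum (g : ℝ → ℝ) {m : ℕ} (β : Fin m → ℝ) :
    2 * pairSum g β = ∑ i, ∑ j ∈ {i}ᶜ, g |β j - β i| := by
  rw [← sum_Ioi_add_symm, pairSum, Finset.mul_sum]
  refine Finset.sum_congr rfl fun i _ => ?_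
  rw [Finset.mul_sum]
  refine Finset.sum_congr rfl fun j _ => ?_
  rw [abs_sub_comm (β i) (β j), two_mul]

/-- Adding the diagonal terms g 0 completes the sum over pairs to a full double sum, which can be
reindexed. This permits sorting the angles. -/
theorem pairSum_comp_perm (g : ℝ → ℝ) {m : ℕ} (β : Fin m → ℝ) (σ : Equiv.Perm (Fin m)) :
    pairSum g (β ∘ σ) = pairSum g β := by
  have h : ∀ β : Fin m → ℝ, 2 * pairSum g β = ∑ i, ∑ j, g |β j - β i| - ∑ i : Fin m, g 0 := by
    intro β
    rw [two_mul_pairSum, ← Finset.sum_sub_distrib]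
    refine Finset.sum_congr rfl fun i _ => ?_
    rw [← Finset.sum_compl_add_sum {i} fun j => g |β j - β i|]
    simp
  have h1 : ∑ i, ∑ j, g |(β ∘ σ) j - (β ∘ σ) i| = ∑ i, ∑ j, g |β j - β i| := by
    rw [← Equiv.sum_comp σ fun i => ∑ j, g |β j - β i|]
    refine Finset.sum_congr rfl fun i _ => ?_
    exact Equiv.sum_comp σ fun j => g |β j - β (σ i)|
  have h2 := h (β ∘ σ)
  rw [h1, ← h β] at h2
  linarith

/-- For j ≠ i the differences i - j run once through the nonzero residues mod m, so the off-diagonal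
row sums of a circulant array do not depend on the row. -/
theorem sum_compl_int_sub {m : ℕ} (e : ℤ → ℝ) (he : ∀ d : ℤ, 0 < d → d < m → e (d - m) = e d)
    (i : Fin m) : ∑ j ∈ {i}ᶜ, e ((i : ℕ) - (j : ℕ)) = ∑ s ∈ Finset.Icc 1 (m - 1), e s := by
  refine Finset.sum_bij (fun (j : Fin m) _ => if (j : ℕ) < i then (i : ℕ) - j else i + m - j)
    ?_ ?_ ?_ ?_
  · intro j hj
    have hne : (j : ℕ) ≠ i := fun h => by simp [Fin.ext h] at hj
    have := i.2; have := j.2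
    simp only [Finset.mem_Icc]
    split_ifs <;> omega
  · intro j hj j' hj' h
    have hne : (j : ℕ) ≠ i := fun h => by simp [Fin.ext h] at hj
    have hne' : (j' : ℕ) ≠ i := fun h => by simp [Fin.ext h] at hj'
    have := i.2; have := j.2; have := j'.2
    ext
    split_ifs at h <;> omega
  · intro s hs
    rw [Finset.mem_Icc] at hs
    have hi := i.2
    by_cases h : s ≤ i
    · refine ⟨⟨i - s, by omega⟩, ?_, ?_⟩
      · simp only [Finset.mem_compl, Finset.mem_singleton, Fin.ext_iff]; omega
      · dsimp only; split_ifs <;> omega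
    · refine ⟨⟨i + m - s, by omega⟩, ?_, ?_⟩
      · simp only [Finset.mem_compl, Finset.mem_singleton, Fin.ext_iff]; omega
      · dsimp only; split_ifs <;> omega
  · intro j hj
    have hne : (j : ℕ) ≠ i := fun h => by simp [Fin.ext h] at hj
    have h1 := i.2; have h2 := j.2
    split_ifs with h
    · rw [Nat.cast_sub h.le]
    · rw [← he ((i + m - j : ℕ) : ℤ) (by omega) (by omega)]
      congr 1
      omega

theorem regularAngles_sub {m : ℕ} (i j : Fin m) :
    regularAngles m i - regularAngles m j = 2 * π * (((i : ℕ) : ℝ) - ((j : ℕ) : ℝ)) / m := by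
  rw [regularAngles, regularAngles]; ring

theorem abs_regularAngles_sub {m : ℕ} (i j : Fin m) :
    |regularAngles m i - regularAngles m j| = 2 * π * |((i : ℕ) : ℝ) - ((j : ℕ) : ℝ)| / m := by
  rw [regularAngles_sub, abs_div, abs_mul, abs_of_pos two_pi_pos, Nat.abs_cast]

theorem angle_mem_Ioo {m s : ℕ} (hs : s ∈ Finset.Icc 1 (m - 1)) :
    2 * π * (s : ℝ) / m ∈ Ioo 0 (2 * π) := by
  rw [Finset.mem_Icc] at hs
  have hm : (0 : ℝ) < m := by exact_mod_cast (by omega : 0 < m)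
  have h1 : (0 : ℝ) < s := by exact_mod_cast (by omega : 0 < s)
  have h2 : (s : ℝ) < m := by exact_mod_cast (by omega : s < m)
  have := two_pi_pos
  refine ⟨by positivity, ?_⟩
  rw [div_lt_iff₀ hm]
  exact mul_lt_mul_of_pos_left h2 this

theorem angle_reflect {m : ℕ} (hm : 0 < m) (x : ℝ) :
    2 * π - 2 * π * x / m = 2 * π * (m - x) / m := by
  have : (m : ℝ) ≠ 0 := by positivity
  field_simp

/-- An even function of the angle, evaluated at the multiples of `2π/m`. -/
theorem evenAngle_shift {m : ℕ} (f : ℝ → ℝ) (hf : ∀ s ∈ Finset.Icc 1 (m - 1),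
      f (2 * π - 2 * π * (s : ℝ) / m) = f (2 * π * (s : ℝ) / m)) (d : ℤ) (h0 : 0 < d) (hd : d < m) :
    f (2 * π * |((d - m : ℤ) : ℝ)| / m) = f (2 * π * |(d : ℝ)| / m) := by
  lift d to ℕ using h0.le
  have hdR : (d : ℝ) < m := by exact_mod_cast hd
  have := hf d (by rw [Finset.mem_Icc]; omega)
  rw [angle_reflect (by omega)] at this
  push_cast
  rw [abs_of_neg (by linarith), Nat.abs_cast, ← this, neg_sub]

theorem IsAdmissible.eventually_symm {g : ℝ → ℝ} {m : ℕ} (hg : IsAdmissible g m) {x : ℝ}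
    (hx : x ∈ Ioo 0 (2 * π)) : g =ᶠ[𝓝 x] fun y => g (2 * π - y) := by
  filter_upwards [Ioo_mem_nhds hx.1 hx.2] with y hy
  exact hg.symm y ⟨hy.1.le, hy.2.le⟩

theorem IsAdmissible.deriv_symm {g : ℝ → ℝ} {m : ℕ} (hg : IsAdmissible g m) {x : ℝ}
    (hx : x ∈ Ioo 0 (2 * π)) : deriv g x = -deriv g (2 * π - x) := by
  rw [(hg.eventually_symm hx).deriv_eq, deriv_comp_const_sub]

theorem IsAdmissible.deriv2_symm {g : ℝ → ℝ} {m : ℕ} (hg : IsAdmissible g m) {x : ℝ}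
    (hx : x ∈ Ioo 0 (2 * π)) : iteratedDeriv 2 g (2 * π - x) = iteratedDeriv 2 g x := by
  have h : deriv g =ᶠ[𝓝 x] fun y => -deriv g (2 * π - y) := by
    filter_upwards [Ioo_mem_nhds hx.1 hx.2] with y hy
    exact hg.deriv_symm hy
  have e : ∀ y, iteratedDeriv 2 g y = deriv (deriv g) y := fun y => by
    rw [iteratedDeriv_succ, iteratedDeriv_one]
  rw [e, e, h.deriv_eq, deriv.fun_neg, deriv_comp_const_sub, neg_neg]

theorem pairSum_regularAngles {g : ℝ → ℝ} {m : ℕ} (hg : IsAdmissible g m) :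
    pairSum g (regularAngles m) = maxValue g m := by
  have h : ∀ i : Fin m, ∑ j ∈ {i}ᶜ, g |regularAngles m j - regularAngles m i| =
      ∑ s ∈ Finset.Icc 1 (m - 1), g (2 * π * (s : ℝ) / m) := by
    intro i
    have := sum_compl_int_sub (m := m) (fun d => g (2 * π * |(d : ℝ)| / m))
      (fun d h0 hd => evenAngle_shift g (fun s hs =>
        (hg.symm _ ⟨(angle_mem_Ioo hs).1.le, (angle_mem_Ioo hs).2.le⟩).symm) d h0 hd) i
    simp only [Int.cast_natCast, Nat.abs_cast] at this
    rw [← this]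
    refine Finset.sum_congr rfl fun j _ => ?_
    rw [abs_regularAngles_sub, abs_sub_comm]
    push_cast
    rfl
  have h2 := two_mul_pairSum g (regularAngles m)
  simp_rw [h] at h2
  rw [maxValue, ← Finset.mul_sum]
  simp only [Finset.sum_const, Finset.card_univ, Fintype.card_fin, nsmul_eq_mul] at h2
  linarith

/-- The weighted sum of squared differences which is minus twice the second-order part of
`pairSum g` at the regular polygon. -/
noncomputable def quadForm (g : ℝ → ℝ) {m : ℕ} (h : Fin m → ℝ) : ℝ :=
  ∑ i : Fin m, ∑ j ∈ Finset.Ioi i,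
    -iteratedDeriv 2 g (regularAngles m j - regularAngles m i) * (h j - h i) ^ 2

theorem sub_mem_Icc_of_mem_Ioi {m : ℕ} {i j : Fin m} (hj : j ∈ Finset.Ioi i) :
    (j : ℕ) - (i : ℕ) ∈ Finset.Icc 1 (m - 1) ∧
      regularAngles m j - regularAngles m i = 2 * π * ((j - i : ℕ) : ℝ) / m := by
  have h : (i : ℕ) < j := Fin.lt_def.1 (Finset.mem_Ioi.1 hj)
  have := j.2
  refine ⟨by rw [Finset.mem_Icc]; omega, ?_⟩
  rw [regularAngles_sub, Nat.cast_sub h.le]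

/-- The coefficient of each h i is a row sum of the odd function e built from g'. The reflection s ↦
m - s changes its sign, because g' is odd about π. -/
theorem firstOrder_eq_zero {g : ℝ → ℝ} {m : ℕ} (hg : IsAdmissible g m) (h : Fin m → ℝ) :
    ∑ i : Fin m, ∑ j ∈ Finset.Ioi i,
      deriv g (regularAngles m j - regularAngles m i) * (h j - h i) = 0 := by
  set e : ℤ → ℝ := fun d => (d.sign : ℝ) * deriv g (2 * π * |(d : ℝ)| / m) with he
  have hodd : ∀ d, e (-d) = -e d := fun d => by simp [he, Int.sign_neg]
  have hnat : ∀ s ∈ Finset.Icc 1 (m - 1), e s = deriv g (2 * π * (s : ℝ) / m) := by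
    intro s hs
    rw [Finset.mem_Icc] at hs
    simp [he, Int.sign_eq_one_of_pos (by omega : (0 : ℤ) < s)]
  have hrefl : ∀ s ∈ Finset.Icc 1 (m - 1), e ((m - s : ℕ) : ℤ) = -e s := by
    intro s hs
    have hs' := Finset.mem_Icc.1 hs
    rw [hnat s hs, hnat _ (by rw [Finset.mem_Icc]; omega), hg.deriv_symm (angle_mem_Ioo hs),
      neg_neg, angle_reflect (by omega), Nat.cast_sub (by omega)]
  have hshift : ∀ d : ℤ, 0 < d → d < m → e (d - m) = e d := by
    intro d h0 hd
    lift d to ℕ using h0.le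
    have := hrefl d (by rw [Finset.mem_Icc]; omega)
    rw [show ((d : ℤ) - m) = -((m - d : ℕ) : ℤ) by omega, hodd, this, neg_neg]
  have hR : ∑ s ∈ Finset.Icc 1 (m - 1), e s = 0 := by
    have : ∑ s ∈ Finset.Icc 1 (m - 1), e s = ∑ s ∈ Finset.Icc 1 (m - 1), -e s := by
      refine Finset.sum_nbij' (fun s => m - s) (fun s => m - s) ?_ ?_ ?_ ?_ ?_
      · intro s hs; simp only [Finset.mem_Icc] at hs ⊢; omega
      · intro s hs; simp only [Finset.mem_Icc] at hs ⊢; omega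
      · intro s hs; simp only [Finset.mem_Icc] at hs ⊢; omega
      · intro s hs; simp only [Finset.mem_Icc] at hs ⊢; omega
      · intro s hs; rw [hrefl s hs, neg_neg]
    rw [Finset.sum_neg_distrib] at this
    linarith
  calc _ = ∑ i : Fin m, ∑ j ∈ Finset.Ioi i,
        (e ((j : ℕ) - (i : ℕ)) * h j + e ((i : ℕ) - (j : ℕ)) * h i) := by
        refine Finset.sum_congr rfl fun i _ => Finset.sum_congr rfl fun j hj => ?_
        obtain ⟨h1, h2⟩ := sub_mem_Icc_of_mem_Ioi hj
        have hij : (i : ℕ) < j := Fin.lt_def.1 (Finset.mem_Ioi.1 hj)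
        have e1 : (((j : ℕ) : ℤ) - ((i : ℕ) : ℤ)) = ((j - i : ℕ) : ℤ) := by omega
        rw [← neg_sub ((j : ℕ) : ℤ) ((i : ℕ) : ℤ), hodd, e1, hnat _ h1, h2]
        ring
    _ = ∑ i : Fin m, ∑ j ∈ {i}ᶜ, e ((i : ℕ) - (j : ℕ)) * h i := sum_Ioi_add_symm fun i j =>
        e (((i : ℕ) : ℤ) - ((j : ℕ) : ℤ)) * h i
    _ = 0 := by
        refine Finset.sum_eq_zero fun i _ => ?_
        rw [← Finset.sum_mul, sum_compl_int_sub e hshift, hR, zero_mul]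

theorem eventually_taylor_two {g : ℝ → ℝ} {a : ℝ} (hg : ContDiffAt ℝ 2 g a) {η : ℝ} (hη : 0 < η) :
    ∀ᶠ d in 𝓝 (0 : ℝ),
      |g (a + d) - g a - deriv g a * d - iteratedDeriv 2 g a / 2 * d ^ 2| ≤ η * d ^ 2 := by
  obtain ⟨u, hu, hgu⟩ := hg.contDiffOn (m := 2) le_rfl (by simp)
  obtain ⟨r, hr, hru⟩ := Metric.mem_nhds_iff.1 hu
  have ha := Metric.mem_ball_self (x := a) hr
  have h := taylor_isLittleO (convex_ball a r) ha (n := 2) (hgu.mono hru)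
  rw [Metric.isOpen_ball.nhdsWithin_eq ha] at h
  have h2 := h.bound hη
  have ht : Tendsto (fun d : ℝ => a + d) (𝓝 0) (𝓝 a) := by
    have : ContinuousAt (fun d : ℝ => a + d) 0 := by fun_prop
    simpa [ContinuousAt] using this
  filter_upwards [ht.eventually h2] with d hd
  have hW : ∀ n, iteratedDerivWithin n g (Metric.ball a r) a = iteratedDeriv n g a := fun n =>
    iteratedDerivWithin_of_isOpen Metric.isOpen_ball ha
  simp only [taylorWithinEval_succ, taylor_within_zero_eval, hW, Real.norm_eq_abs,
    add_sub_cancel_left, smul_eq_mul, zero_add, iteratedDeriv_one] at hd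
  rw [abs_of_nonneg (sq_nonneg d)] at hd
  convert hd using 2
  norm_num [Nat.factorial]
  ring

theorem abs_sub_le_two_norm {m : ℕ} (h : Fin m → ℝ) (i j : Fin m) : |h j - h i| ≤ 2 * ‖h‖ := by
  have h1 := norm_le_pi_norm h i
  have h2 := norm_le_pi_norm h j
  rw [Real.norm_eq_abs] at h1 h2
  have := abs_sub (h j) (h i)
  linarith

/-- Second-order expansion of `pairSum g` at the regular polygon. -/
theorem eventually_pairSum_taylor {g : ℝ → ℝ} {m : ℕ} (hg : IsAdmissible g m) {η : ℝ}
    (hη : 0 < η) : ∀ᶠ h in 𝓝 (0 : Fin m → ℝ),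
      |maxValue g m - pairSum g (regularAngles m + h) - quadForm g h / 2| ≤ η * ‖h‖ ^ 2 := by
  -- At most m² pairs each contribute η' (2‖h‖)²; the `+ 1` keeps the denominator positive.
  set η' : ℝ := η / (4 * m ^ 2 + 1) with hη'
  have hη'0 : 0 < η' := by positivity
  have hpair : ∀ᶠ h in 𝓝 (0 : Fin m → ℝ), ∀ i j : Fin m, j ∈ Finset.Ioi i →
      |g |(regularAngles m + h) j - (regularAngles m + h) i|
        - g |regularAngles m j - regularAngles m i|
        - deriv g (regularAngles m j - regularAngles m i) * (h j - h i)
        + -iteratedDeriv 2 g (regularAngles m j - regularAngles m i) * (h j - h i) ^ 2 / 2|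
      ≤ η' * (h j - h i) ^ 2 := by
    rw [eventually_all]; intro i
    rw [eventually_all]; intro j
    rw [eventually_imp_distrib_left]; intro hj
    obtain ⟨h1, h2⟩ := sub_mem_Icc_of_mem_Ioi hj
    have ht : Tendsto (fun h : Fin m → ℝ => h j - h i) (𝓝 0) (𝓝 0) := by
      have : Continuous fun h : Fin m → ℝ => h j - h i := by fun_prop
      simpa using this.tendsto 0
    have hpos := (angle_mem_Ioo h1).1
    rw [← h2] at hpos
    filter_upwards [ht.eventually (eventually_taylor_two (hg.smooth _ h1) hη'0),
      ht.eventually (lt_mem_nhds (neg_lt_zero.2 hpos))] with h hh hh2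
    rw [← h2] at hh
    have e1 : |(regularAngles m + h) j - (regularAngles m + h) i| =
        regularAngles m j - regularAngles m i + (h j - h i) := by
      rw [Pi.add_apply, Pi.add_apply, abs_of_pos (by linarith)]; ring
    rw [e1, abs_of_pos hpos]
    convert hh using 2
    ring
  filter_upwards [hpair] with h hh
  have e : maxValue g m - pairSum g (regularAngles m + h) - quadForm g h / 2 =
      -∑ i : Fin m, ∑ j ∈ Finset.Ioi i,
        (g |(regularAngles m + h) j - (regularAngles m + h) i|
        - g |regularAngles m j - regularAngles m i|
        - deriv g (regularAngles m j - regularAngles m i) * (h j - h i)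
        + -iteratedDeriv 2 g (regularAngles m j - regularAngles m i) * (h j - h i) ^ 2 / 2) := by
    simp only [Finset.sum_add_distrib, Finset.sum_sub_distrib, firstOrder_eq_zero hg h,
      ← pairSum_regularAngles hg, ← Finset.sum_div]
    simp only [pairSum, quadForm]
    ring
  rw [e, abs_neg]
  calc _ ≤ ∑ i : Fin m, ∑ j ∈ Finset.Ioi i, η' * (2 * ‖h‖) ^ 2 := by
        refine (Finset.abs_sum_le_sum_abs _ _).trans (Finset.sum_le_sum fun i _ =>
          (Finset.abs_sum_le_sum_abs _ _).trans (Finset.sum_le_sum fun j hj =>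
          (hh i j hj).trans (mul_le_mul_of_nonneg_left ?_ hη'0.le)))
        exact sq_le_sq' (by have := abs_le.1 (abs_sub_le_two_norm h i j); linarith)
          (le_of_abs_le (abs_sub_le_two_norm h i j))
    _ ≤ ∑ i : Fin m, ∑ j : Fin m, η' * (2 * ‖h‖) ^ 2 :=
        Finset.sum_le_sum fun i _ => Finset.sum_le_sum_of_subset_of_nonneg
          (Finset.subset_univ _) fun _ _ _ => by positivity
    _ = η / (4 * m ^ 2 + 1) * (4 * m ^ 2) * ‖h‖ ^ 2 := by
        simp only [Finset.sum_const, Finset.card_univ, Fintype.card_fin, nsmul_eq_mul, hη']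
        ring
    _ ≤ η * ‖h‖ ^ 2 := by
        refine mul_le_mul_of_nonneg_right ?_ (by positivity)
        rw [div_mul_eq_mul_div, div_le_iff₀ (by positivity)]
        nlinarith

end Kernel

/-! ### Positive definiteness of -G and quadratic growth of the deficit -/

section Growth

open Matrix

/-- The matrix `-G` for `m = k + 1`. -/
noncomputable def negHessian (g : ℝ → ℝ) (k : ℕ) : Matrix (Fin k) (Fin k) ℝ :=
  -(matrixG g (k + 1) : Matrix (Fin k) (Fin k) ℝ)

theorem negHessian_det_ne_zero {g : ℝ → ℝ} {k : ℕ} (h : (matrixG g (k + 1)).det ≠ 0) :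
    (negHessian g k).det ≠ 0 := by
  rw [negHessian, det_neg]
  exact mul_ne_zero (pow_ne_zero _ (by norm_num)) h

theorem negHessian_apply (g : ℝ → ℝ) (k : ℕ) (i j : Fin k) :
    negHessian g k i j =
      if i = j then -∑ s ∈ Finset.Icc 1 k, iteratedDeriv 2 g (2 * π * (s : ℝ) / ((k + 1 : ℕ) : ℝ))
      else iteratedDeriv 2 g (2 * π * |((i : ℕ) : ℝ) - ((j : ℕ) : ℝ)| / ((k + 1 : ℕ) : ℝ)) := by
  have : negHessian g k i j = -(if i = j then ∑ s ∈ Finset.Icc 1 k,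
      iteratedDeriv 2 g (2 * π * (s : ℝ) / ((k + 1 : ℕ) : ℝ)) else
      -iteratedDeriv 2 g (2 * π * |((i : ℕ) : ℝ) - ((j : ℕ) : ℝ)| / ((k + 1 : ℕ) : ℝ))) := rfl
  rw [this]
  split_ifs <;> simp

/-- Expanding the squares puts minus a row sum of g'' on the diagonal, and evenness of g'' about π
makes all these row sums equal. -/
theorem quadForm_eq_sum {g : ℝ → ℝ} {m : ℕ} (hg : IsAdmissible g m) (h : Fin m → ℝ) :
    quadForm g h = ∑ i : Fin m, ∑ j : Fin m, (if i = j then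
      -∑ s ∈ Finset.Icc 1 (m - 1), iteratedDeriv 2 g (2 * π * (s : ℝ) / m)
      else iteratedDeriv 2 g (2 * π * |((i : ℕ) : ℝ) - ((j : ℕ) : ℝ)| / m)) * (h i * h j) := by
  set e : ℤ → ℝ := fun d => iteratedDeriv 2 g (2 * π * |(d : ℝ)| / m) with he
  have hR : ∀ i : Fin m, ∑ j ∈ {i}ᶜ, e ((i : ℕ) - (j : ℕ)) =
      ∑ s ∈ Finset.Icc 1 (m - 1), iteratedDeriv 2 g (2 * π * (s : ℝ) / m) := by
    intro i
    rw [sum_compl_int_sub e (fun d h0 hd => evenAngle_shift _ (fun s hs =>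
      hg.deriv2_symm (angle_mem_Ioo hs)) d h0 hd) i]
    simp [he]
  calc quadForm g h = ∑ i : Fin m, ∑ j ∈ Finset.Ioi i,
        (-e ((j : ℕ) - (i : ℕ)) * (h j ^ 2 - h j * h i)
          + -e ((i : ℕ) - (j : ℕ)) * (h i ^ 2 - h i * h j)) := by
        refine Finset.sum_congr rfl fun i _ => Finset.sum_congr rfl fun j hj => ?_
        obtain ⟨h1, h2⟩ := sub_mem_Icc_of_mem_Ioi hj
        have e1 : regularAngles m j - regularAngles m i =
            2 * π * |((j : ℕ) : ℝ) - ((i : ℕ) : ℝ)| / m := by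
          rw [← abs_regularAngles_sub, abs_of_pos (h2 ▸ (angle_mem_Ioo h1).1)]
        simp only [he]
        push_cast
        rw [e1, abs_sub_comm ((i : ℕ) : ℝ)]
        ring
    _ = ∑ i : Fin m, ∑ j ∈ {i}ᶜ, -e ((i : ℕ) - (j : ℕ)) * (h i ^ 2 - h i * h j) :=
        sum_Ioi_add_symm fun i j =>
          -e (((i : ℕ) : ℤ) - ((j : ℕ) : ℤ)) * (h i ^ 2 - h i * h j)
    _ = _ := by
        refine Finset.sum_congr rfl fun i _ => ?_
        rw [← Finset.sum_compl_add_sum {i}, Finset.sum_singleton, if_pos rfl, ← hR i]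
        simp only [mul_sub, Finset.sum_sub_distrib, ← Finset.sum_mul, Finset.sum_neg_distrib]
        have : ∑ j ∈ {i}ᶜ, -e ((i : ℕ) - (j : ℕ)) * (h i * h j) =
            -∑ j ∈ {i}ᶜ, (if i = j then -∑ j ∈ {i}ᶜ, e ((i : ℕ) - (j : ℕ)) else
              iteratedDeriv 2 g (2 * π * |((i : ℕ) : ℝ) - ((j : ℕ) : ℝ)| / m)) * (h i * h j) := by
          rw [← Finset.sum_neg_distrib]
          refine Finset.sum_congr rfl fun j hj => ?_
          rw [if_neg (by rintro rfl; simp at hj)]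
          simp only [he]
          push_cast
          ring
        rw [this]
        ring

/-- Fixing the first angle removes the rotational degeneracy: deleting row and column 0 of the full
m × m matrix leaves -G. -/
theorem quadForm_cons {g : ℝ → ℝ} {k : ℕ} (hg : IsAdmissible g (k + 1)) (y : Fin k → ℝ) :
    quadForm g (Fin.cons 0 y : Fin (k + 1) → ℝ) = y ⬝ᵥ (negHessian g k *ᵥ y) := by
  rw [quadForm_eq_sum hg, Fin.sum_univ_succ]
  simp only [Fin.cons_zero, zero_mul, mul_zero, Finset.sum_const_zero, zero_add, Fin.sum_univ_succ,
    Fin.cons_succ, dotProduct, mulVec, Finset.mul_sum]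
  refine Finset.sum_congr rfl fun i _ => Finset.sum_congr rfl fun j _ => ?_
  rw [negHessian_apply]
  simp only [Fin.succ_inj, Fin.val_succ, Nat.add_sub_cancel]
  have : |((((i : ℕ) + 1 : ℕ)) : ℝ) - (((j : ℕ) + 1 : ℕ) : ℝ)| =
      |((i : ℕ) : ℝ) - ((j : ℕ) : ℝ)| := by
    push_cast; congr 1; ring
  rw [this]
  ring

/-- Midpoint concavity bounds the symmetric second difference at a by 0, and Taylor's formula
compares that difference with g''(a). -/
theorem IsAdmissible.deriv2_nonpos {g : ℝ → ℝ} {m : ℕ} (hg : IsAdmissible g m) {s : ℕ}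
    (hs : s ∈ Finset.Icc 1 (m - 1)) : iteratedDeriv 2 g (2 * π * (s : ℝ) / m) ≤ 0 := by
  set a := 2 * π * (s : ℝ) / m
  have ha : a ∈ Ioo 0 (2 * π) := angle_mem_Ioo hs
  refine le_of_forall_pos_le_add fun η hη => ?_
  have hsm : ContDiffAt ℝ 2 g a := hg.smooth s hs
  have h1 := eventually_taylor_two hsm (half_pos hη)
  have h2 : ∀ᶠ d in 𝓝 (0 : ℝ), a + d ∈ Ioo 0 (2 * π) := by
    have : Tendsto (fun d : ℝ => a + d) (𝓝 0) (𝓝 a) := by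
      have : ContinuousAt (fun d : ℝ => a + d) 0 := by fun_prop
      simpa [ContinuousAt] using this
    exact this.eventually (Ioo_mem_nhds ha.1 ha.2)
  obtain ⟨r, hr, h⟩ := Metric.eventually_nhds_iff.1 (h1.and h2)
  obtain ⟨h3, h4⟩ := h (y := r / 2) (by simp [abs_of_pos hr, hr])
  obtain ⟨h5, h6⟩ := h (y := -(r / 2)) (by simp [abs_of_pos hr, hr])
  have hc := hg.conc.2 ⟨h4.1.le, h4.2.le⟩ ⟨h6.1.le, h6.2.le⟩
    (by norm_num : (0 : ℝ) ≤ 1 / 2) (by norm_num : (0 : ℝ) ≤ 1 / 2) (by norm_num)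
  simp only [smul_eq_mul] at hc
  rw [show 1 / 2 * (a + r / 2) + 1 / 2 * (a + -(r / 2)) = a by ring] at hc
  have h7 := (abs_le.1 h3).1
  have h8 := (abs_le.1 h5).1
  have hr2 : 0 < (r / 2) ^ 2 := by positivity
  have : iteratedDeriv 2 g a * (r / 2) ^ 2 ≤ (0 + η) * (r / 2) ^ 2 := by nlinarith
  exact le_of_mul_le_mul_right this hr2

theorem quadForm_nonneg {g : ℝ → ℝ} {m : ℕ} (hg : IsAdmissible g m) (h : Fin m → ℝ) :
    0 ≤ quadForm g h := by
  refine Finset.sum_nonneg fun i _ => Finset.sum_nonneg fun j hj => ?_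
  obtain ⟨h1, h2⟩ := sub_mem_Icc_of_mem_Ioi hj
  rw [h2]
  exact mul_nonneg (neg_nonneg.2 (hg.deriv2_nonpos h1)) (sq_nonneg _)

/-- The form is a sum of squares with weights -g'' ≥ 0, hence semidefinite; the nonzero determinant
excludes a kernel. -/
theorem negHessian_posDef {g : ℝ → ℝ} {k : ℕ} (hg : IsAdmissible g (k + 1))
    (hG : (matrixG g (k + 1)).det ≠ 0) : (negHessian g k).PosDef := by
  have hH : (negHessian g k).IsHermitian := by
    ext i j
    rw [conjTranspose_apply, star_trivial, negHessian_apply, negHessian_apply, abs_sub_comm]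
    by_cases h : i = j
    · simp [h]
    · rw [if_neg h, if_neg (Ne.symm h)]
  have hS : (negHessian g k).PosSemidef := by
    refine PosSemidef.of_dotProduct_mulVec_nonneg hH fun y => ?_
    rw [star_trivial, ← quadForm_cons hg]
    exact quadForm_nonneg hg _
  exact hS.posDef_iff_det_ne_zero.2 (negHessian_det_ne_zero hG)

theorem exists_pos_mul_norm_sq_le {k : ℕ} {A : Matrix (Fin k) (Fin k) ℝ} (hA : A.PosDef) :
    ∃ c : ℝ, 0 < c ∧ ∀ y : Fin k → ℝ, c * ‖y‖ ^ 2 ≤ y ⬝ᵥ (A *ᵥ y) := by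
  have hcont : Continuous fun y : Fin k → ℝ => y ⬝ᵥ (A *ᵥ y) := by
    simp only [dotProduct, mulVec]; fun_prop
  -- The sphere is empty exactly when k = 0; otherwise c is the minimum of the form on it.
  rcases (Metric.sphere (0 : Fin k → ℝ) 1).eq_empty_or_nonempty with hs | hs
  · refine ⟨1, one_pos, fun y => ?_⟩
    have hy : y = 0 := by
      by_contra hy
      have : ‖y‖⁻¹ • y ∈ Metric.sphere (0 : Fin k → ℝ) 1 := by
        rw [mem_sphere_zero_iff_norm, norm_smul, norm_inv, norm_norm,
          inv_mul_cancel₀ (norm_ne_zero_iff.2 hy)]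
      rw [hs] at this
      exact this
    simp [hy]
  · obtain ⟨x, hx, hmin⟩ := (isCompact_sphere (0 : Fin k → ℝ) 1).exists_isMinOn hs hcont.continuousOn
    have hx0 : x ≠ 0 := by rintro rfl; simp at hx
    refine ⟨x ⬝ᵥ (A *ᵥ x), by simpa using hA.dotProduct_mulVec_pos hx0, fun y => ?_⟩
    by_cases hy : y = 0
    · simp [hy]
    have hn : ‖y‖ ≠ 0 := norm_ne_zero_iff.2 hy
    have : ‖y‖⁻¹ • y ∈ Metric.sphere (0 : Fin k → ℝ) 1 := by
      rw [mem_sphere_zero_iff_norm, norm_smul, norm_inv, norm_norm, inv_mul_cancel₀ hn]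
    have h := hmin this
    simp only [mem_ofPred_eq, mulVec_smul, dotProduct_smul, smul_dotProduct, smul_eq_mul] at h
    calc _ ≤ ‖y‖⁻¹ * (‖y‖⁻¹ * (y ⬝ᵥ (A *ᵥ y))) * ‖y‖ ^ 2 :=
          mul_le_mul_of_nonneg_right h (by positivity)
      _ = _ := by field_simp

theorem norm_le_norm_tail {k : ℕ} (h : Fin (k + 1) → ℝ) (h0 : h 0 = 0) : ‖h‖ ≤ ‖Fin.tail h‖ := by
  refine (pi_norm_le_iff_of_nonneg (norm_nonneg _)).2 fun i => ?_
  refine Fin.cases ?_ (fun i => ?_) i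
  · simp [h0]
  · exact norm_le_pi_norm (Fin.tail h) i

/-- On ordered configurations the differences have a fixed sign, so the absolute values are linear
and concavity of g passes to the sum. -/
theorem pairSum_concave {g : ℝ → ℝ} (hg : ConcaveOn ℝ (Icc 0 (2 * π)) g) {m : ℕ}
    {β γ : Fin m → ℝ} (hβ : Monotone β) (hγ : Monotone γ) (hβI : ∀ i, β i ∈ Icc 0 (2 * π))
    (hγI : ∀ i, γ i ∈ Icc 0 (2 * π)) {a b : ℝ} (ha : 0 ≤ a) (hb : 0 ≤ b) (hab : a + b = 1) :
    a * pairSum g β + b * pairSum g γ ≤ pairSum g (a • β + b • γ) := by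
  simp only [pairSum, Finset.mul_sum, ← Finset.sum_add_distrib]
  refine Finset.sum_le_sum fun i _ => Finset.sum_le_sum fun j hj => ?_
  have hij := (Finset.mem_Ioi.1 hj).le
  have h1 := hβ hij
  have h2 := hγ hij
  have e : (a • β + b • γ) j - (a • β + b • γ) i = a * (β j - β i) + b * (γ j - γ i) := by
    simp only [Pi.add_apply, Pi.smul_apply, smul_eq_mul]; ring
  have h3 : 0 ≤ a * (β j - β i) := mul_nonneg ha (by linarith)
  have h4 : 0 ≤ b * (γ j - γ i) := mul_nonneg hb (by linarith)
  rw [abs_of_nonneg (sub_nonneg.2 h1), abs_of_nonneg (sub_nonneg.2 h2), e,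
    abs_of_nonneg (add_nonneg h3 h4)]
  have m1 : β j - β i ∈ Icc 0 (2 * π) :=
    ⟨by linarith, by have := (hβI j).2; have := (hβI i).1; linarith⟩
  have m2 : γ j - γ i ∈ Icc 0 (2 * π) :=
    ⟨by linarith, by have := (hγI j).2; have := (hγI i).1; linarith⟩
  simpa using hg.2 m1 m2 ha hb hab

theorem regularAngles_mem {m : ℕ} (i : Fin m) : regularAngles m i ∈ Ico 0 (2 * π) := by
  have hm : (0 : ℝ) < m := by exact_mod_cast i.pos
  have h2 : ((i : ℕ) : ℝ) < m := by exact_mod_cast i.2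
  have := two_pi_pos
  refine ⟨by rw [regularAngles]; positivity, ?_⟩
  rw [regularAngles, div_lt_iff₀ hm]
  exact mul_lt_mul_of_pos_left h2 this

theorem regularAngles_strictMono (m : ℕ) : StrictMono (regularAngles m) := by
  intro i j hij
  obtain ⟨h1, h2⟩ := sub_mem_Icc_of_mem_Ioi (Finset.mem_Ioi.2 hij)
  have := (angle_mem_Ioo h1).1
  linarith

/-- On ordered configurations the deficit of `pairSum g` is at least quadratic in the distance
to the regular polygon. -/
theorem exists_growth {g : ℝ → ℝ} {k : ℕ} (hg : IsAdmissible g (k + 1))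
    (hG : (matrixG g (k + 1)).det ≠ 0) : ∃ c : ℝ, 0 < c ∧ ∀ β : Fin (k + 1) → ℝ, Monotone β →
      β 0 = 0 → (∀ i, β i ∈ Icc 0 (2 * π)) →
      c * ‖β - regularAngles (k + 1)‖ ^ 2 ≤ maxValue g (k + 1) - pairSum g β := by
  obtain ⟨c₀, hc₀, hpos⟩ := exists_pos_mul_norm_sq_le (negHessian_posDef hg hG)
  set b := regularAngles (k + 1) with hb
  have hb0 : b 0 = 0 := by simp [hb, regularAngles]
  have hQ : ∀ h : Fin (k + 1) → ℝ, h 0 = 0 → c₀ * ‖h‖ ^ 2 ≤ quadForm g h := by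
    intro h h0
    have e : h = Fin.cons 0 (Fin.tail h) := by rw [← h0, Fin.cons_self_tail]
    calc c₀ * ‖h‖ ^ 2 ≤ c₀ * ‖Fin.tail h‖ ^ 2 := by
          have := norm_le_norm_tail h h0
          gcongr
      _ ≤ _ := hpos _
      _ = quadForm g h := by rw [← quadForm_cons hg, ← e]
  obtain ⟨r₀, hr₀, hT⟩ := Metric.eventually_nhds_iff.1
    (eventually_pairSum_taylor hg (η := c₀ / 4) (by positivity))
  obtain ⟨r, hr, hrr₀⟩ : ∃ r, 0 < r ∧ r < r₀ := ⟨r₀ / 2, by linarith, by linarith⟩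
  have hsmall : ∀ h : Fin (k + 1) → ℝ, h 0 = 0 → ‖h‖ ≤ r →
      c₀ / 4 * ‖h‖ ^ 2 ≤ maxValue g (k + 1) - pairSum g (b + h) := by
    intro h h0 hh
    have h1 := (abs_le.1 (hT (y := h) (by rw [dist_zero_right]; linarith))).1
    have h2 := hQ h h0
    linarith
  have hpi := two_pi_pos
  -- Within distance r, the Taylor error c₀/4 leaves c₀/2 - c₀/4. Farther away, the segment from b
  -- to β has deficit at least c₀r²/4 at distance r, so by concavity the deficit at β is at least
  -- c₀r‖h‖/4; then ‖h‖ ≤ 2π turns linear growth into quadratic.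
  refine ⟨min (c₀ / 4) (c₀ / 4 * (r / (2 * π))), by positivity, fun β hβ h0 hI => ?_⟩
  set h := β - b with hh
  have hβh : β = b + h := by rw [hh]; abel
  have hh0 : h 0 = 0 := by rw [hh, Pi.sub_apply, h0, hb0, sub_zero]
  rcases le_or_gt ‖h‖ r with hle | hgt
  · refine (mul_le_mul_of_nonneg_right (min_le_left _ _) (by positivity)).trans ?_
    rw [hβh]
    exact hsmall h hh0 hle
  · have hn : 0 < ‖h‖ := hr.trans hgt
    have hn2 : ‖h‖ ≤ 2 * π := by
      refine (pi_norm_le_iff_of_nonneg hpi.le).2 fun i => ?_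
      have h1 := hI i
      have h2 := regularAngles_mem i
      rw [Real.norm_eq_abs, abs_le, hh, Pi.sub_apply]
      exact ⟨by linarith [h1.1, h2.2], by linarith [h1.2, h2.1]⟩
    set τ := r / ‖h‖ with hτ
    have hτ0 : 0 < τ := by positivity
    have hτ1 : τ ≤ 1 := (div_le_one hn).2 hgt.le
    have hnτ : ‖τ • h‖ = r := by
      rw [norm_smul, Real.norm_eq_abs, abs_of_pos hτ0, hτ, div_mul_cancel₀ _ hn.ne']
    have h1 := hsmall (τ • h) (by simp [hh0]) hnτ.le
    have h2 := pairSum_concave hg.conc (regularAngles_strictMono (k + 1)).monotone hβ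
      (fun i => ⟨(regularAngles_mem i).1, (regularAngles_mem i).2.le⟩) hI
      (a := 1 - τ) (b := τ) (by linarith) hτ0.le (by ring)
    have e : (1 - τ) • b + τ • β = b + τ • h := by
      rw [hh, smul_sub, sub_smul, one_smul]; abel
    rw [← hb, e, pairSum_regularAngles hg] at h2
    rw [hnτ] at h1
    have h3 : c₀ / 4 * r ^ 2 ≤ τ * (maxValue g (k + 1) - pairSum g β) := by linarith
    have h4 : c₀ / 4 * r ^ 2 = τ * (c₀ / 4 * r * ‖h‖) := by
      rw [hτ]; field_simp
    rw [h4] at h3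
    refine le_trans ?_ (le_of_mul_le_mul_left h3 hτ0)
    refine (mul_le_mul_of_nonneg_right (min_le_right _ _) (by positivity)).trans ?_
    calc c₀ / 4 * (r / (2 * π)) * ‖h‖ ^ 2 = c₀ / 4 * r * ‖h‖ * (‖h‖ / (2 * π)) := by
          field_simp
      _ ≤ c₀ / 4 * r * ‖h‖ * 1 := by
          gcongr
          exact (div_le_one hpi).2 hn2
      _ = _ := mul_one _

/-- Along a fixed direction the rescaled deficit converges to half the quadratic form. -/
theorem tendsto_deficit {g : ℝ → ℝ} {k : ℕ} (hg : IsAdmissible g (k + 1)) (y : Fin k → ℝ) :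
    Tendsto (fun s : ℝ => (maxValue g (k + 1) -
      pairSum g (regularAngles (k + 1) + s • (Fin.cons 0 y : Fin (k + 1) → ℝ))) / s ^ 2)
      (𝓝[>] 0) (𝓝 (y ⬝ᵥ (negHessian g k *ᵥ y) / 2)) := by
  set h : Fin (k + 1) → ℝ := Fin.cons 0 y with hh
  rw [← quadForm_cons hg, ← hh, Metric.tendsto_nhds]
  intro ε hε
  have hη : 0 < ε / (‖h‖ ^ 2 + 1) := by positivity
  have ht : Tendsto (fun s : ℝ => s • h) (𝓝[>] 0) (𝓝 0) := by
    have : Continuous fun s : ℝ => s • h := by fun_prop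
    simpa using (this.tendsto 0).mono_left nhdsWithin_le_nhds
  filter_upwards [ht.eventually (eventually_pairSum_taylor hg hη), self_mem_nhdsWithin] with s hs hs0
  have hs0 : 0 < s := hs0
  have hq : quadForm g (s • h) = s ^ 2 * quadForm g h := by
    simp only [quadForm, Finset.mul_sum, Pi.smul_apply, smul_eq_mul]
    refine Finset.sum_congr rfl fun i _ => Finset.sum_congr rfl fun j _ => ?_
    ring
  rw [hq, norm_smul, Real.norm_eq_abs, abs_of_pos hs0] at hs
  have hs2 : 0 < s ^ 2 := by positivity
  rw [Real.dist_eq]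
  have e : (maxValue g (k + 1) - pairSum g (regularAngles (k + 1) + s • h)) / s ^ 2 -
      quadForm g h / 2 = (maxValue g (k + 1) - pairSum g (regularAngles (k + 1) + s • h) -
      s ^ 2 * quadForm g h / 2) / s ^ 2 := by
    field_simp
  rw [e, abs_div, abs_of_pos hs2, div_lt_iff₀ hs2]
  refine hs.trans_lt ?_
  rw [mul_pow, div_mul_eq_mul_div, div_lt_iff₀ (by positivity)]
  have := norm_nonneg h
  nlinarith [mul_pos hε hs2]

end Growth

/-! ### Volume of the limiting ellipsoid, by a factorization A = BᵀB -/

section EllipsoidVolume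

open Matrix
open scoped MatrixOrder Matrix.Norms.L2Operator

theorem _root_.Matrix.PosDef.exists_eq_transpose_mul_self {k : ℕ} {A : Matrix (Fin k) (Fin k) ℝ}
    (hA : A.PosDef) : ∃ B : Matrix (Fin k) (Fin k) ℝ, A = Bᵀ * B := by
  obtain ⟨B, hB⟩ := CStarAlgebra.nonneg_iff_eq_star_mul_self.mp hA.posSemidef.nonneg
  exact ⟨B, by rw [hB, star_eq_conjTranspose, conjTranspose_eq_transpose_of_trivial]⟩

end EllipsoidVolume

section Geometry

open Matrix

theorem quadratic_eq_norm_sq {k : ℕ} (B : Matrix (Fin k) (Fin k) ℝ) (y : Fin k → ℝ) :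
    y ⬝ᵥ ((Bᵀ * B) *ᵥ y) = ‖WithLp.toLp 2 (B *ᵥ y)‖ ^ 2 := by
  rw [EuclideanSpace.norm_sq_eq, ← mulVec_mulVec, dotProduct_mulVec, vecMul_transpose, dotProduct]
  refine Finset.sum_congr rfl fun i _ => ?_
  simp only [Real.norm_eq_abs, sq_abs]
  ring

theorem volume_toLp_mulVec_preimage {k : ℕ} {B : Matrix (Fin k) (Fin k) ℝ} (hB : B.det ≠ 0)
    {s : Set (EuclideanSpace ℝ (Fin k))} (hs : MeasurableSet s) :
    volume {y : Fin k → ℝ | WithLp.toLp 2 (B *ᵥ y) ∈ s} =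
      ENNReal.ofReal |B.det⁻¹| * volume s := by
  have h := Measure.addHaar_preimage_linearMap (volume : Measure (Fin k → ℝ))
    (f := Matrix.toLin' B) (by rwa [LinearMap.det_toLin']) ((WithLp.toLp 2) ⁻¹' s)
  rw [LinearMap.det_toLin',
    (PiLp.volume_preserving_toLp (Fin k)).measure_preimage hs.nullMeasurableSet] at h
  exact h

/-- The boundary of the ellipsoid is the only place where the rescaled indicators may fail to
converge. -/
theorem volume_quadratic_eq_two {k : ℕ} {A : Matrix (Fin k) (Fin k) ℝ}
    (hA : A.PosDef) : volume {y : Fin k → ℝ | y ⬝ᵥ (A *ᵥ y) = 2} = 0 := by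
  obtain ⟨B, rfl⟩ := hA.exists_eq_transpose_mul_self
  have hB : B.det ≠ 0 := by
    intro h
    have := hA.det_pos
    simp [h] at this
  have e : {y : Fin k → ℝ | y ⬝ᵥ ((Bᵀ * B) *ᵥ y) = 2} =
      {y | WithLp.toLp 2 (B *ᵥ y) ∈ Metric.sphere (0 : EuclideanSpace ℝ (Fin k)) √2} := by
    ext y
    rw [mem_ofPred_eq, mem_ofPred_eq, mem_sphere_zero_iff_norm, quadratic_eq_norm_sq,
      ← Real.sqrt_inj (by positivity) (by norm_num), Real.sqrt_sq (norm_nonneg _)]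
  rw [e, volume_toLp_mulVec_preimage hB Metric.isClosed_sphere.measurableSet,
    Measure.addHaar_sphere_of_ne_zero _ _ (by positivity), mul_zero]

/-- The threshold is 2 because the rescaled deficit tends to half the quadratic form and is compared
with 1. B maps the set onto a ball of radius √2. -/
theorem volume_quadratic_lt_two {k : ℕ} (hk : 0 < k) {A : Matrix (Fin k) (Fin k) ℝ}
    (hA : A.PosDef) : volume {y : Fin k → ℝ | y ⬝ᵥ (A *ᵥ y) < 2} =
      ENNReal.ofReal ((2 * π) ^ ((k : ℝ) / 2) / (√A.det * Real.Gamma ((k : ℝ) / 2 + 1))) := by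
  obtain ⟨B, rfl⟩ := hA.exists_eq_transpose_mul_self
  have hB : B.det ≠ 0 := by
    intro h
    have := hA.det_pos
    simp [h] at this
  have e : {y : Fin k → ℝ | y ⬝ᵥ ((Bᵀ * B) *ᵥ y) < 2} =
      {y | WithLp.toLp 2 (B *ᵥ y) ∈ Metric.ball (0 : EuclideanSpace ℝ (Fin k)) √2} := by
    ext y
    rw [mem_ofPred_eq, mem_ofPred_eq, mem_ball_zero_iff, quadratic_eq_norm_sq,
      Real.lt_sqrt (norm_nonneg _)]
  have : Nonempty (Fin k) := ⟨⟨0, hk⟩⟩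
  rw [e, volume_toLp_mulVec_preimage hB Metric.isOpen_ball.measurableSet,
    EuclideanSpace.volume_ball, Fintype.card_fin, ← ENNReal.ofReal_pow (by positivity),
    ← ENNReal.ofReal_mul (by positivity), ← ENNReal.ofReal_mul (by positivity)]
  congr 1
  have h1 : √(Bᵀ * B).det = |B.det| := by
    rw [det_mul, det_transpose, ← sq, Real.sqrt_sq_eq_abs]
  have h2 : (2 * π) ^ ((k : ℝ) / 2) = √2 ^ k * √π ^ k := by
    rw [← mul_pow, ← Real.sqrt_mul (by norm_num), Real.sqrt_eq_rpow, ← Real.rpow_natCast,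
      ← Real.rpow_mul (by positivity)]
    congr 1
    ring
  rw [h1, h2, abs_inv]
  field_simp

end Geometry

/-! ### Integrals of symmetric functions, rescaling, product densities -/

section Symmetrization

theorem ae_injective (k : ℕ) : ∀ᵐ β : Fin k → ℝ, Function.Injective β := by
  have h : ∀ i j : Fin k, i ≠ j → ∀ᵐ β : Fin k → ℝ, β i ≠ β j := by
    intro i j hij
    have := Measure.addHaar_submodule (volume : Measure (Fin k → ℝ))
      (LinearMap.ker (LinearMap.proj (R := ℝ) (φ := fun _ : Fin k => ℝ) i - LinearMap.proj j)) (by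
        intro htop
        have : Pi.single i (1 : ℝ) ∈ LinearMap.ker
            (LinearMap.proj (R := ℝ) (φ := fun _ : Fin k => ℝ) i - LinearMap.proj j) := by
          rw [htop]; trivial
        simp [hij.symm] at this)
    rw [ae_iff]
    refine measure_mono_null (fun β hβ => ?_) this
    simp only [ne_eq, not_not, mem_ofPred_eq] at hβ
    simp [hβ]
  have h' : ∀ᵐ β : Fin k → ℝ, ∀ i j : Fin k, i ≠ j → β i ≠ β j := by
    rw [ae_all_iff]; intro i
    rw [ae_all_iff]; intro j
    by_cases hij : i = j
    · simp [hij]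
    · filter_upwards [h i j hij] with β hβ _ using hβ
  filter_upwards [h'] with β hβ i j hij
  by_contra hne
  exact hβ i j hne hij

theorem measurePreserving_comp_perm {k : ℕ} (σ : Equiv.Perm (Fin k)) :
    MeasurePreserving (fun β : Fin k → ℝ => β ∘ σ) := by
  have h := volume_measurePreserving_piCongrLeft (fun _ : Fin k => ℝ) σ.symm
  have e : (fun β : Fin k → ℝ => β ∘ σ) =
      MeasurableEquiv.piCongrLeft (fun _ : Fin k => ℝ) σ.symm := by
    funext β i
    have := MeasurableEquiv.piCongrLeft_apply_apply σ.symm (β := fun _ => ℝ) β (σ i)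
    rw [σ.symm_apply_apply] at this
    rw [this]
    rfl
  rw [e]
  exact h

theorem measurableSet_strictMono (k : ℕ) : MeasurableSet {β : Fin k → ℝ | StrictMono β} := by
  have : {β : Fin k → ℝ | StrictMono β} = ⋂ i, ⋂ j, {β | i < j → β i < β j} := by
    ext β; simp only [mem_ofPred_eq, mem_iInter]; rfl
  rw [this]
  refine MeasurableSet.iInter fun i => MeasurableSet.iInter fun j => ?_
  by_cases h : i < j
  · simpa [h] using measurableSet_lt (measurable_pi_apply i) (measurable_pi_apply j)
  · simp [h]

/-- The integral of a symmetric function is `k!` times its integral over increasing tuples. -/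
theorem lintegral_eq_factorial_mul_strictMono {k : ℕ} {h : (Fin k → ℝ) → ENNReal}
    (hm : Measurable h) (hsymm : ∀ β (σ : Equiv.Perm (Fin k)), h (β ∘ σ) = h β) :
    ∫⁻ β, h β = (Nat.factorial k : ENNReal) * ∫⁻ β in {β | StrictMono β}, h β := by
  classical
  set C : Set (Fin k → ℝ) := {β | StrictMono β}
  have hC : MeasurableSet C := measurableSet_strictMono k
  -- A tuple with distinct entries is made increasing by exactly one permutation.
  have h1 : ∀ᵐ β : Fin k → ℝ, h β = ∑ σ : Equiv.Perm (Fin k), C.indicator h (β ∘ σ) := by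
    filter_upwards [ae_injective k] with β hβ
    have hs : StrictMono (β ∘ Tuple.sort β) :=
      (Tuple.monotone_sort β).strictMono_of_injective (hβ.comp (Tuple.sort β).injective)
    rw [Finset.sum_eq_single (Tuple.sort β)]
    · rw [indicator_of_mem hs, hsymm]
    · intro σ _ hσ
      refine indicator_of_notMem (fun hσC => hσ ?_) _
      have := Tuple.unique_monotone (StrictMono.monotone hσC) hs.monotone
      ext i
      rw [hβ (congrFun this i)]
    · simp
  have h3 : ∀ σ : Equiv.Perm (Fin k), Measurable fun β : Fin k → ℝ => C.indicator h (β ∘ σ) :=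
    fun σ => (hm.indicator hC).comp (measurePreserving_comp_perm σ).measurable
  rw [lintegral_congr_ae h1, lintegral_finsetSum _ fun σ _ => h3 σ]
  have h2 : ∀ σ : Equiv.Perm (Fin k), ∫⁻ β : Fin k → ℝ, C.indicator h (β ∘ σ) = ∫⁻ β in C, h β :=
    fun σ => by
      rw [(measurePreserving_comp_perm σ).lintegral_comp (hm.indicator hC), lintegral_indicator hC]
  simp [h2, Fintype.card_perm]

theorem lintegral_eq_pow_mul_lintegral_affine {k : ℕ} (b : Fin k → ℝ) {s : ℝ} (hs : 0 < s)
    {h : (Fin k → ℝ) → ENNReal} (hm : Measurable h) :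
    ∫⁻ β, h β = ENNReal.ofReal (s ^ k) * ∫⁻ y, h (b + s • y) := by
  rw [← lintegral_add_left_eq_self h b]
  have hm' : Measurable fun β => h (b + β) := hm.comp (measurable_const_add b)
  have h1 := Measure.map_addHaar_smul (volume : Measure (Fin k → ℝ)) hs.ne'
  have h2 := lintegral_map (μ := (volume : Measure (Fin k → ℝ))) hm'
    (g := fun y => s • y) (measurable_const_smul s)
  rw [h1, lintegral_smul_measure, Module.finrank_fintype_fun_eq_card, Fintype.card_fin] at h2
  rw [← h2, smul_eq_mul, ← mul_assoc, ← ENNReal.ofReal_mul (by positivity),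
    abs_of_pos (by positivity), mul_inv_cancel₀ (by positivity), ENNReal.ofReal_one, one_mul]

theorem lintegral_pi_prod {k : ℕ} {X : Type*} [MeasurableSpace X] (ν : Fin k → Measure X)
    [∀ i, SigmaFinite (ν i)] {f : Fin k → X → ENNReal} (hf : ∀ i, Measurable (f i)) :
    ∫⁻ x, ∏ i, f i (x i) ∂(Measure.pi ν) = ∏ i, ∫⁻ x, f i x ∂(ν i) := by
  induction k with
  | zero => simp
  | succ k ih =>
    have hm : Measurable fun x : Fin (k + 1) → X => ∏ i, f i (x i) :=
      Finset.measurable_prod _ fun i _ => (hf i).comp (measurable_pi_apply i)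
    have hmp := (measurePreserving_piFinSuccAbove ν 0).symm
    rw [← hmp.lintegral_comp hm, Fin.prod_univ_succ, ← ih (fun i => ν i.succ) fun i => hf i.succ]
    have hm2 : Measurable fun x : Fin k → X => ∏ i, f i.succ (x i) :=
      Finset.measurable_prod _ fun i _ => (hf i.succ).comp (measurable_pi_apply i)
    rw [← lintegral_prod_mul (hf 0).aemeasurable hm2.aemeasurable]
    refine lintegral_congr fun z => ?_
    rw [Fin.prod_univ_succ]
    rfl

theorem pi_withDensity_apply {k : ℕ} {X : Type*} [MeasurableSpace X] (ν : Measure X)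
    [SigmaFinite ν] {f : X → ENNReal} (hf : Measurable f) [SigmaFinite (ν.withDensity f)] :
    Measure.pi (fun _ : Fin k => ν.withDensity f) =
      (Measure.pi fun _ : Fin k => ν).withDensity fun x => ∏ i, f (x i) := by
  refine Measure.pi_eq fun s hs => ?_
  rw [withDensity_apply _ (MeasurableSet.univ_pi hs), ← lintegral_indicator (.univ_pi hs)]
  have : ∀ x : Fin k → X, (univ.pi s).indicator (fun x => ∏ i, f (x i)) x =
      ∏ i, (s i).indicator f (x i) := by
    intro x
    by_cases hx : x ∈ univ.pi s
    · rw [indicator_of_mem hx]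
      exact Finset.prod_congr rfl fun i _ => (indicator_of_mem (hx i trivial) f).symm
    · rw [indicator_of_notMem hx]
      simp only [Set.mem_pi, mem_univ, true_implies, not_forall] at hx
      obtain ⟨i, hi⟩ := hx
      exact (Finset.prod_eq_zero (Finset.mem_univ i) (indicator_of_notMem hi f)).symm
  simp_rw [this]
  rw [lintegral_pi_prod _ fun i => hf.indicator (hs i)]
  exact Finset.prod_congr rfl fun i _ => by
    rw [lintegral_indicator (hs i), withDensity_apply _ (hs i)]

end Symmetrization

/-! ### Central angles and measurability of the kernel -/

section CentralAngle

theorem centralAngle_exp (x θ : ℝ) :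
    centralAngle (Circle.exp x) (Circle.exp θ) = toIcoMod two_pi_pos 0 (θ - x) := by
  rw [centralAngle, ← Circle.exp_sub, Circle.coe_exp, Complex.arg_exp_mul_I, toIcoMod_toIocMod]

theorem centralAngle_self (z : Circle) : centralAngle z z = 0 := by
  rw [centralAngle, div_self']
  simp [toIcoMod_apply_left]

theorem centralAngle_mem (z w : Circle) : centralAngle z w ∈ Ico 0 (2 * π) :=
  toIcoMod_mem_Ico' _ _

theorem measurable_toIcoMod_two_pi : Measurable (toIcoMod two_pi_pos 0) := by
  have : toIcoMod two_pi_pos 0 = fun b : ℝ => Int.fract (b / (2 * π)) * (2 * π) :=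
    funext fun b => toIcoMod_eq_fract_mul two_pi_pos b
  rw [this]
  exact (measurable_fract.comp (measurable_id.div_const _)).mul_const _

theorem measurable_centralAngle : Measurable fun q : Circle × Circle => centralAngle q.1 q.2 := by
  have h : Measurable fun q : Circle × Circle => ((q.2 / q.1 : Circle) : ℂ) := by
    have : Continuous fun q : Circle × Circle => ((q.2 / q.1 : Circle) : ℂ) := by
      simp only [Circle.coe_div]
      have h (f : Circle × Circle → Circle) (hf : Continuous f) :
          Continuous fun q => ((f q : Circle) : ℂ) := continuous_induced_dom.comp hf
      exact (h _ continuous_snd).div (h _ continuous_fst) fun q => Circle.coe_ne_zero _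
    exact this.measurable
  exact measurable_toIcoMod_two_pi.comp (Complex.measurable_arg.comp h)

end CentralAngle

section Angles

attribute [local irreducible] centralAngle

theorem measurable_angleFromFirst {m : ℕ} : Measurable (angleFromFirst (m := m)) :=
  measurable_pi_lambda _ fun i => by
    have h : Measurable fun u : Fin m → Circle => (u ⟨0, i.pos⟩, u i) :=
      (measurable_pi_apply _).prodMk (measurable_pi_apply _)
    exact measurable_centralAngle.comp h

theorem angleFromFirst_eq_cons {k : ℕ} (u : Fin (k + 1) → Circle) :
    angleFromFirst u = Fin.cons 0 fun i : Fin k => centralAngle (u 0) (u i.succ) := by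
  funext i
  refine Fin.cases ?_ (fun i => ?_) i
  · exact centralAngle_self _
  · rfl

/-- The continuous extension of `g` from `[0, 2π]` to the real line by constants. -/
noncomputable def extendConst (g : ℝ → ℝ) : ℝ → ℝ :=
  IccExtend two_pi_pos.le ((Icc 0 (2 * π)).domRestrict g)

theorem continuous_extendConst {g : ℝ → ℝ} (hg : ContinuousOn g (Icc 0 (2 * π))) :
    Continuous (extendConst g) :=
  (ContinuousOn.domRestrict hg).Icc_extend'

theorem extendConst_of_mem (g : ℝ → ℝ) {x : ℝ} (hx : x ∈ Icc 0 (2 * π)) :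
    extendConst g x = g x := by
  rw [extendConst, IccExtend_of_mem _ _ hx]; rfl

theorem pairSum_extendConst (g : ℝ → ℝ) {m : ℕ} {β : Fin m → ℝ} (hβ : ∀ i, β i ∈ Ico 0 (2 * π)) :
    pairSum (extendConst g) β = pairSum g β := by
  refine Finset.sum_congr rfl fun i _ => Finset.sum_congr rfl fun j _ => ?_
  refine extendConst_of_mem g ⟨abs_nonneg _, ?_⟩
  have h1 := hβ i
  have h2 := hβ j
  exact abs_le.2 ⟨by linarith [h1.2, h2.1], by linarith [h1.1, h2.2]⟩

theorem continuous_pairSum {g : ℝ → ℝ} (hg : Continuous g) {m : ℕ} :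
    Continuous (pairSum g (m := m)) := by
  refine continuous_finsetSum _ fun i _ => continuous_finsetSum _ fun j _ => ?_
  exact hg.comp (by fun_prop)

/-- Nothing is known about g outside [0, 2π], so measurability passes through a continuous
extension; differences of angles in [0, 2π) never see the change. -/
theorem measurable_pairKernel {g : ℝ → ℝ} (hg : ContinuousOn g (Icc 0 (2 * π))) {m : ℕ} :
    Measurable (pairKernel g (m := m)) := by
  have : pairKernel g (m := m) = fun u => pairSum (extendConst g) (angleFromFirst u) := by
    funext u
    exact (pairSum_extendConst g (β := angleFromFirst u) fun i => centralAngle_mem _ _).symm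
  rw [this]
  exact (continuous_pairSum (continuous_extendConst hg)).measurable.comp measurable_angleFromFirst

end Angles

/-! ### Joint law of the angles seen from the first point -/

section Law

attribute [local irreducible] centralAngle

theorem _root_.Function.Periodic.setLIntegral_Ico_add {F : ℝ → ENNReal} {T : ℝ} (hT : 0 < T)
    (hF : Function.Periodic F T) (x : ℝ) :
    ∫⁻ β in Ico 0 T, F (x + β) = ∫⁻ θ in Ico 0 T, F θ := by
  have : Fact (0 < T) := ⟨hT⟩
  have h1 := AddCircle.lintegral_preimage T x hF.lift
  have h2 := AddCircle.lintegral_preimage T 0 hF.lift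
  simp only [Function.Periodic.lift_coe, zero_add] at h1 h2
  have h3 := (measurePreserving_add_left volume x).setLIntegral_comp_preimage_emb
    (measurableEmbedding_addLeft x) F (Ioc x (x + T))
  have e : (fun β => x + β) ⁻¹' Ioc x (x + T) = Ioc 0 T := by
    ext β; simp
  rw [e, h1, ← h2] at h3
  rw [setLIntegral_congr Ico_ae_eq_Ioc, h3, setLIntegral_congr Ico_ae_eq_Ioc]

variable {p : ℝ → ℝ}

theorem IsContinuousCircleDensity.measurable_ofReal (hp : IsContinuousCircleDensity p) :
    Measurable fun x => ENNReal.ofReal (p x) := hp.continuous.measurable.ennreal_ofReal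

theorem IsContinuousCircleDensity.exists_bound (hp : IsContinuousCircleDensity p) :
    ∃ P : ℝ, 0 < P ∧ ∀ x, p x ≤ P := by
  obtain ⟨P, hP⟩ := (isCompact_Icc (a := (0 : ℝ)) (b := 2 * π)).bddAbove_image
    hp.continuous.continuousOn
  refine ⟨max P 1, by positivity, fun x => le_max_of_le_left ?_⟩
  obtain ⟨y, hy, hxy⟩ := hp.periodic.exists_mem_Ico₀ two_pi_pos x
  rw [hxy]
  exact hP ⟨y, ⟨hy.1, hy.2.le⟩, rfl⟩

theorem IsContinuousCircleDensity.lintegral_eq_one (hp : IsContinuousCircleDensity p) :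
    ∫⁻ x in Ico 0 (2 * π), ENNReal.ofReal (p x) = 1 := by
  rw [setLIntegral_congr Ico_ae_eq_Ioc, ← ofReal_integral_eq_lintegral_ofReal,
    ← intervalIntegral.integral_of_le two_pi_pos.le, hp.integral_eq_one, ENNReal.ofReal_one]
  · exact hp.continuous.integrableOn_Ioc
  · exact Eventually.of_forall hp.nonneg

theorem isProbabilityMeasure_withDensity (hp : IsContinuousCircleDensity p) (x : ℝ) :
    IsProbabilityMeasure ((volume.restrict (Ico (0 : ℝ) (2 * π))).withDensity
      fun β => ENNReal.ofReal (p (x + β))) := by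
  refine ⟨?_⟩
  have hper : Function.Periodic (fun θ => ENNReal.ofReal (p θ)) (2 * π) := fun θ => by
    simp only [hp.periodic θ]
  rw [withDensity_apply _ MeasurableSet.univ, Measure.restrict_univ]
  exact (hper.setLIntegral_Ico_add two_pi_pos x).trans hp.lintegral_eq_one

theorem isProbabilityMeasure_circleLaw (hp : IsContinuousCircleDensity p) :
    IsProbabilityMeasure (circleLaw p) := by
  have := isProbabilityMeasure_withDensity hp 0
  simp only [zero_add] at this
  exact Measure.isProbabilityMeasure_map Circle.exp.continuous.aemeasurable

/-- A periodic function has the same integral over every window of length 2π, so measuring angles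
from x only translates the density. -/
theorem map_centralAngle_circleLaw (hp : IsContinuousCircleDensity p) (x : ℝ) :
    (circleLaw p).map (centralAngle (Circle.exp x)) =
      (volume.restrict (Ico (0 : ℝ) (2 * π))).withDensity fun β => ENNReal.ofReal (p (x + β)) := by
  have hcA : Measurable (centralAngle (Circle.exp x)) :=
    measurable_centralAngle.comp (measurable_const.prodMk measurable_id)
  have hexp : Measurable fun θ : ℝ => Circle.exp θ := Circle.exp.continuous.measurable
  ext A hA
  have hmod : Measurable fun θ : ℝ => toIcoMod two_pi_pos 0 (θ - x) :=
    measurable_toIcoMod_two_pi.comp (measurable_id.sub_const x)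
  set F : ℝ → ENNReal := fun θ =>
    A.indicator (fun _ => ENNReal.ofReal (p θ)) (toIcoMod two_pi_pos 0 (θ - x)) with hF
  have hFper : Function.Periodic F (2 * π) := by
    intro θ
    have : toIcoMod two_pi_pos 0 (θ + 2 * π - x) = toIcoMod two_pi_pos 0 (θ - x) := by
      rw [add_sub_right_comm, toIcoMod_add_right]
    simp only [hF, this, hp.periodic θ]
  rw [circleLaw, Measure.map_map hcA hexp, Measure.map_apply (hcA.comp hexp) hA,
    withDensity_apply _ (hA.preimage (hcA.comp hexp)), withDensity_apply _ hA]
  have e : (centralAngle (Circle.exp x) ∘ fun θ : ℝ => Circle.exp θ) =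
      fun θ : ℝ => toIcoMod two_pi_pos 0 (θ - x) := funext fun θ => centralAngle_exp x θ
  rw [e, ← lintegral_indicator (hA.preimage hmod), ← lintegral_indicator hA,
    show ∀ f : ℝ → ENNReal, ((fun θ : ℝ => toIcoMod two_pi_pos 0 (θ - x)) ⁻¹' A).indicator f =
      fun θ => A.indicator (fun _ => f θ) (toIcoMod two_pi_pos 0 (θ - x)) from fun f => rfl]
  refine (hFper.setLIntegral_Ico_add two_pi_pos x).symm.trans ?_
  refine setLIntegral_congr_fun measurableSet_Ico fun β hβ => ?_
  have : toIcoMod two_pi_pos 0 (x + β - x) = β := by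
    rw [add_sub_cancel_left, toIcoMod_eq_self]
    simpa using hβ
  simp only [hF, this]
  rfl

/-- The joint law of the angles measured from the first point. -/
theorem pi_circleLaw_angles (hp : IsContinuousCircleDensity p) {k : ℕ} {S : Set (Fin k → ℝ)}
    (hS : MeasurableSet S) :
    (Measure.pi fun _ : Fin (k + 1) => circleLaw p)
      {u | (fun i : Fin k => centralAngle (u 0) (u i.succ)) ∈ S} =
    ∫⁻ x in Ico 0 (2 * π), ENNReal.ofReal (p x) *
      ∫⁻ β, (S ∩ univ.pi fun _ => Ico 0 (2 * π)).indicator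
        (fun β : Fin k → ℝ => ∏ i, ENNReal.ofReal (p (x + β i))) β := by
  have hprob := isProbabilityMeasure_circleLaw hp
  have hang : Measurable fun q : Circle × (Fin k → Circle) => fun i => centralAngle q.1 (q.2 i) :=
    measurable_pi_lambda _ fun i => measurable_centralAngle.comp
      (measurable_fst.prodMk ((measurable_pi_apply i).comp measurable_snd))
  -- Splitting off the first point and applying Fubini leaves, for each fixed value x of its angle,
  -- k independent angles with density p(x + ·).
  have hmp := measurePreserving_piFinSuccAbove (fun _ : Fin (k + 1) => circleLaw p) 0
  have hpre := hmp.measure_preimage (hang hS).nullMeasurableSet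
  have hm1 : Measurable fun z => (Measure.pi fun _ : Fin k => circleLaw p)
      (Prod.mk z ⁻¹' ((fun q : Circle × (Fin k → Circle) => fun i => centralAngle q.1 (q.2 i)) ⁻¹' S)) :=
    measurable_measure_prodMk_left (hang hS)
  have hexp : Measurable fun θ : ℝ => Circle.exp θ := Circle.exp.continuous.measurable
  refine hpre.trans ?_
  rw [Measure.prod_apply (hang hS)]
  refine (lintegral_map (μ := (volume.restrict (Ico (0 : ℝ) (2 * π))).withDensity
    fun x => ENNReal.ofReal (p x)) hm1 hexp).trans ?_
  refine (lintegral_withDensity_eq_lintegral_mul _ hp.measurable_ofReal (hm1.comp hexp)).trans ?_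
  refine lintegral_congr fun x => ?_
  rw [Pi.mul_apply]
  congr 1
  have := isProbabilityMeasure_withDensity hp x
  have hcA : Measurable (centralAngle (Circle.exp x)) :=
    measurable_centralAngle.comp (measurable_const.prodMk measurable_id)
  have : ∀ _ : Fin k, SigmaFinite ((circleLaw p).map (centralAngle (Circle.exp x))) := fun _ => by
    rw [map_centralAngle_circleLaw hp x]; infer_instance
  have hmap := Measure.pi_map_pi (μ := fun _ : Fin k => circleLaw p)
    (f := fun _ => centralAngle (Circle.exp x)) (fun _ => hcA.aemeasurable)
  have e : (Measure.pi fun _ : Fin k => circleLaw p)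
      (Prod.mk (Circle.exp x) ⁻¹' ((fun q : Circle × (Fin k → Circle) =>
        fun i => centralAngle q.1 (q.2 i)) ⁻¹' S)) =
      ((Measure.pi fun _ : Fin k => circleLaw p).map
        fun w i => centralAngle (Circle.exp x) (w i)) S := by
    have hm : Measurable fun (w : Fin k → Circle) i => centralAngle (Circle.exp x) (w i) :=
      measurable_pi_lambda _ fun i => hcA.comp (measurable_pi_apply i)
    rw [Measure.map_apply hm hS]
    rfl
  have hpx : Measurable fun β => ENNReal.ofReal (p (x + β)) :=
    hp.measurable_ofReal.comp (measurable_const_add x)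
  refine e.trans ?_
  rw [hmap, map_centralAngle_circleLaw hp x, pi_withDensity_apply _ hpx, withDensity_apply _ hS,
    ← Measure.restrict_pi_pi, Measure.restrict_restrict hS, ← lintegral_indicator]
  · rfl
  · exact hS.inter (MeasurableSet.univ_pi fun _ => measurableSet_Ico)

end Law

/-! ### Probability of a small deficit -/

section Asymptotics

open Matrix

/-- The angle configurations (relative to the first point) whose deficit is at most `ε`. -/
def nearMaximal (g : ℝ → ℝ) (k : ℕ) (ε : ℝ) : Set (Fin k → ℝ) :=
  {β | (∀ i, β i ∈ Ico 0 (2 * π)) ∧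
    maxValue g (k + 1) - pairSum g (Fin.cons 0 β : Fin (k + 1) → ℝ) ≤ ε}

theorem cons_zero_mem_Ico {k : ℕ} {β : Fin k → ℝ} (hβ : ∀ i, β i ∈ Ico 0 (2 * π))
    (i : Fin (k + 1)) : (Fin.cons 0 β : Fin (k + 1) → ℝ) i ∈ Ico 0 (2 * π) := by
  refine Fin.cases ?_ (fun i => ?_) i
  · exact ⟨le_rfl, two_pi_pos⟩
  · exact hβ i

theorem continuous_cons_zero (k : ℕ) :
    Continuous fun β : Fin k → ℝ => (Fin.cons 0 β : Fin (k + 1) → ℝ) :=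
  continuous_pi fun i => by
    refine Fin.cases ?_ (fun i => ?_) i
    · simpa using continuous_const
    · simpa using continuous_apply i

theorem measurableSet_nearMaximal {g : ℝ → ℝ} (hg : ContinuousOn g (Icc 0 (2 * π))) (k : ℕ)
    (ε : ℝ) : MeasurableSet (nearMaximal g k ε) := by
  have e : nearMaximal g k ε = (univ.pi fun _ => Ico 0 (2 * π)) ∩
      {β | maxValue g (k + 1) - pairSum (extendConst g) (Fin.cons 0 β : Fin (k + 1) → ℝ) ≤ ε} := by
    ext β
    simp only [nearMaximal, mem_ofPred_eq, mem_inter_iff, Set.mem_pi, mem_univ, true_implies]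
    refine and_congr_right fun hβ => ?_
    rw [pairSum_extendConst g (cons_zero_mem_Ico hβ)]
  rw [e]
  refine (MeasurableSet.univ_pi fun _ => measurableSet_Ico).inter ?_
  refine measurableSet_le (Continuous.measurable ?_) measurable_const
  exact continuous_const.sub
    ((continuous_pairSum (continuous_extendConst hg)).comp (continuous_cons_zero k))

theorem setOf_deficit_le (g : ℝ → ℝ) (k : ℕ) (ε : ℝ) :
    {u : Fin (k + 1) → Circle | maxValue g (k + 1) - pairKernel g u ≤ ε} =
      {u | (fun i : Fin k => centralAngle (u 0) (u i.succ)) ∈ nearMaximal g k ε} := by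
  ext u
  simp only [nearMaximal, mem_ofPred_eq, pairKernel_eq_pairSum, angleFromFirst_eq_cons]
  exact (and_iff_right fun i => centralAngle_mem _ _).symm

/-- The permutation extends to one fixing index 0. This symmetry is the source of the factor k!. -/
theorem pairSum_cons_comp_perm (g : ℝ → ℝ) {k : ℕ} (β : Fin k → ℝ) (σ : Equiv.Perm (Fin k)) :
    pairSum g (Fin.cons 0 (β ∘ σ) : Fin (k + 1) → ℝ) =
      pairSum g (Fin.cons 0 β : Fin (k + 1) → ℝ) := by
  rw [← pairSum_comp_perm g (Fin.cons 0 β) (Equiv.Perm.decomposeFin.symm (0, σ))]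
  congr 1
  funext i
  refine Fin.cases ?_ (fun i => ?_) i
  · simp
  · simp [Equiv.Perm.decomposeFin_symm_apply_succ]

theorem comp_perm_mem_nearMaximal (g : ℝ → ℝ) {k : ℕ} (ε : ℝ) (β : Fin k → ℝ)
    (σ : Equiv.Perm (Fin k)) : β ∘ σ ∈ nearMaximal g k ε ↔ β ∈ nearMaximal g k ε := by
  simp only [nearMaximal, mem_ofPred_eq, pairSum_cons_comp_perm, Function.comp_apply]
  rw [σ.forall_congr_left]
  simp

theorem cons_regularAngles_add_smul {k : ℕ} (s : ℝ) (y : Fin k → ℝ) :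
    (Fin.cons 0 (Fin.tail (regularAngles (k + 1)) + s • y) : Fin (k + 1) → ℝ) =
      regularAngles (k + 1) + s • (Fin.cons 0 y : Fin (k + 1) → ℝ) := by
  funext i
  refine Fin.cases ?_ (fun i => ?_) i
  · simp [regularAngles]
  · simp [Fin.tail]

/-- The integrand of the rescaled probability of a small deficit. -/
noncomputable def rescaledDensity (g p : ℝ → ℝ) (k : ℕ) (s : ℝ) (z : ℝ × (Fin k → ℝ)) : ENNReal :=
  ENNReal.ofReal (p z.1) * (nearMaximal g k (s ^ 2) ∩ {β | StrictMono β}).indicator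
    (fun β => ∏ i, ENNReal.ofReal (p (z.1 + β i)))
    (Fin.tail (regularAngles (k + 1)) + s • z.2)

variable {g p : ℝ → ℝ} {k : ℕ}

theorem measurable_prod_density (hp : IsContinuousCircleDensity p) :
    Measurable fun z : ℝ × (Fin k → ℝ) => ∏ i, ENNReal.ofReal (p (z.1 + z.2 i)) :=
  Finset.measurable_prod _ fun i _ => hp.measurable_ofReal.comp
    (measurable_fst.add ((measurable_pi_apply i).comp measurable_snd))

theorem measurable_rescaledDensity (hg : ContinuousOn g (Icc 0 (2 * π)))
    (hp : IsContinuousCircleDensity p) (s : ℝ) : Measurable (rescaledDensity g p k s) := by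
  have haff : Measurable fun z : ℝ × (Fin k → ℝ) =>
      (z.1, Fin.tail (regularAngles (k + 1)) + s • z.2) := by
    have : Continuous fun z : ℝ × (Fin k → ℝ) =>
      (z.1, Fin.tail (regularAngles (k + 1)) + s • z.2) := by fun_prop
    exact this.measurable
  have hS : MeasurableSet ((Prod.snd : ℝ × (Fin k → ℝ) → _) ⁻¹'
      (nearMaximal g k (s ^ 2) ∩ {β | StrictMono β})) :=
    ((measurableSet_nearMaximal hg k _).inter (measurableSet_strictMono k)).preimage measurable_snd
  exact (hp.measurable_ofReal.comp measurable_fst).mul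
    (((measurable_prod_density hp).indicator hS).comp haff)

/-- The probability that the deficit of `m = k + 1` independent points is at most `s ^ 2`. -/
theorem pi_circleLaw_deficit_le (hg : ContinuousOn g (Icc 0 (2 * π)))
    (hp : IsContinuousCircleDensity p) {s : ℝ} (hs : 0 < s) :
    (Measure.pi fun _ : Fin (k + 1) => circleLaw p)
      {u | maxValue g (k + 1) - pairKernel g u ≤ s ^ 2} =
    (Nat.factorial k : ENNReal) * ENNReal.ofReal (s ^ k) *
      ∫⁻ z, rescaledDensity g p k s z ∂((volume.restrict (Ico 0 (2 * π))).prod volume) := by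
  have hN := measurableSet_nearMaximal hg k (s ^ 2)
  have hC := measurableSet_strictMono k
  rw [setOf_deficit_le, pi_circleLaw_angles hp hN,
    lintegral_prod _ (measurable_rescaledDensity hg hp s).aemeasurable,
    ← lintegral_const_mul _ (measurable_rescaledDensity hg hp s).lintegral_prod_right']
  refine lintegral_congr fun x => ?_
  have hbox : nearMaximal g k (s ^ 2) ∩ (univ.pi fun _ => Ico 0 (2 * π)) =
      nearMaximal g k (s ^ 2) := inter_eq_left.2 fun β hβ i _ => hβ.1 i
  have hmx : Measurable fun β : Fin k → ℝ => ∏ i, ENNReal.ofReal (p (x + β i)) :=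
    (measurable_prod_density hp).comp (measurable_const.prodMk measurable_id)
  rw [hbox, lintegral_eq_factorial_mul_strictMono (hmx.indicator hN) fun β σ => ?_,
    ← lintegral_indicator hC, indicator_indicator, inter_comm,
    lintegral_eq_pow_mul_lintegral_affine (Fin.tail (regularAngles (k + 1))) hs
      (hmx.indicator (hN.inter hC))]
  · simp only [rescaledDensity]
    rw [lintegral_const_mul' _ _ ENNReal.ofReal_ne_top]
    ring
  · have hprod : ∏ i, ENNReal.ofReal (p (x + (β ∘ σ) i)) = ∏ i, ENNReal.ofReal (p (x + β i)) :=
      Equiv.prod_comp σ fun i => ENNReal.ofReal (p (x + β i))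
    by_cases h : β ∈ nearMaximal g k (s ^ 2)
    · rw [indicator_of_mem h, indicator_of_mem ((comp_perm_mem_nearMaximal g _ β σ).2 h), hprod]
    · rw [indicator_of_notMem h,
        indicator_of_notMem fun h' => h ((comp_perm_mem_nearMaximal g _ β σ).1 h')]

/-- Quadratic growth gives c‖s y‖² ≤ s²; the resulting bound is independent of s and supplies the
dominating function. -/
theorem norm_le_of_rescaled_mem {c : ℝ} (hc : 0 < c)
    (hgrow : ∀ β : Fin (k + 1) → ℝ, Monotone β → β 0 = 0 → (∀ i, β i ∈ Icc 0 (2 * π)) →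
      c * ‖β - regularAngles (k + 1)‖ ^ 2 ≤ maxValue g (k + 1) - pairSum g β)
    {s : ℝ} (hs : 0 < s) {y : Fin k → ℝ}
    (hy : Fin.tail (regularAngles (k + 1)) + s • y ∈
      nearMaximal g k (s ^ 2) ∩ {β | StrictMono β}) : ‖y‖ ≤ √(1 / c) := by
  obtain ⟨⟨hI, hd⟩, hmono⟩ := hy
  set β := Fin.tail (regularAngles (k + 1)) + s • y with hβ
  have hcI := cons_zero_mem_Ico hI
  have hm : Monotone (Fin.cons 0 β : Fin (k + 1) → ℝ) := by
    intro i j hij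
    induction i using Fin.cases with
    | zero => exact (hcI j).1
    | succ i =>
      induction j using Fin.cases with
      | zero => exact absurd hij (by simp)
      | succ j => exact StrictMono.monotone hmono (Fin.succ_le_succ_iff.1 hij)
  have h1 := hgrow _ hm rfl fun i => ⟨(hcI i).1, (hcI i).2.le⟩
  have e : (Fin.cons 0 β : Fin (k + 1) → ℝ) - regularAngles (k + 1) =
      s • (Fin.cons 0 y : Fin (k + 1) → ℝ) := by
    rw [hβ, cons_regularAngles_add_smul]; abel
  rw [e, norm_smul, Real.norm_eq_abs, abs_of_pos hs] at h1
  have h2 : ‖y‖ ≤ ‖(Fin.cons 0 y : Fin (k + 1) → ℝ)‖ :=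
    (pi_norm_le_iff_of_nonneg (norm_nonneg _)).2 fun i =>
      norm_le_pi_norm (Fin.cons 0 y : Fin (k + 1) → ℝ) i.succ
  refine h2.trans (Real.le_sqrt_of_sq_le ?_)
  rw [le_div_iff₀ hc]
  have hs2 : 0 < s ^ 2 := by positivity
  have h3 := h1.trans hd
  rw [mul_pow] at h3
  have : s ^ 2 * (‖(Fin.cons 0 y : Fin (k + 1) → ℝ)‖ ^ 2 * c) ≤ s ^ 2 * 1 := by linarith
  exact le_of_mul_le_mul_left this hs2

/-- The nonzero vertex angles are strictly ordered and interior to (0, 2π), so the box and ordering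
constraints are inactive near them. -/
theorem eventually_rescaled_box (y : Fin k → ℝ) : ∀ᶠ s : ℝ in 𝓝[>] 0,
    (∀ i, (Fin.tail (regularAngles (k + 1)) + s • y) i ∈ Ico 0 (2 * π)) ∧
      StrictMono (Fin.tail (regularAngles (k + 1)) + s • y) := by
  have hcont : Continuous fun s : ℝ => Fin.tail (regularAngles (k + 1)) + s • y := by fun_prop
  have ht : ∀ i, Tendsto (fun s : ℝ => (Fin.tail (regularAngles (k + 1)) + s • y) i) (𝓝[>] 0)
      (𝓝 (regularAngles (k + 1) i.succ)) := by
    intro i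
    have := ((continuous_apply i).comp hcont).tendsto 0
    simp only [Function.comp_apply, zero_smul, add_zero] at this
    exact this.mono_left nhdsWithin_le_nhds
  have hsm := regularAngles_strictMono (k + 1)
  have h0 : regularAngles (k + 1) 0 = 0 := by simp [regularAngles]
  have h1 : ∀ᶠ s : ℝ in 𝓝[>] 0,
      ∀ i, (Fin.tail (regularAngles (k + 1)) + s • y) i ∈ Ioo 0 (2 * π) := by
    rw [eventually_all]
    intro i
    refine (ht i).eventually (Ioo_mem_nhds ?_ (regularAngles_mem _).2)
    have := hsm (Fin.succ_pos i)
    rwa [h0] at this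
  have h2 : ∀ᶠ s : ℝ in 𝓝[>] 0, ∀ i j : Fin k, i < j →
      (Fin.tail (regularAngles (k + 1)) + s • y) i <
        (Fin.tail (regularAngles (k + 1)) + s • y) j := by
    rw [eventually_all]; intro i
    rw [eventually_all]; intro j
    rw [eventually_imp_distrib_left]; intro hij
    exact (ht i).eventually_lt (ht j) (hsm (Fin.succ_lt_succ_iff.2 hij))
  filter_upwards [h1, h2] with s hs1 hs2
  exact ⟨fun i => ⟨(hs1 i).1.le, (hs1 i).2⟩, fun i j hij => hs2 i j hij⟩

/-- Off the boundary of the ellipsoid, the limit of the rescaled deficit eventually decides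
membership, while continuity of p handles the density factor. -/
theorem tendsto_rescaledDensity (hg : IsAdmissible g (k + 1)) (hp : IsContinuousCircleDensity p)
    (x : ℝ) {y : Fin k → ℝ} (hy : y ⬝ᵥ (negHessian g k *ᵥ y) ≠ 2) :
    Tendsto (fun s => rescaledDensity g p k s (x, y)) (𝓝[>] 0)
      (𝓝 ((ENNReal.ofReal (p x) *
        ∏ i : Fin k, ENNReal.ofReal (p (x + regularAngles (k + 1) i.succ))) *
        {y : Fin k → ℝ | y ⬝ᵥ (negHessian g k *ᵥ y) < 2}.indicator 1 y)) := by
  have hdef := tendsto_deficit hg y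
  have hden : Tendsto (fun s : ℝ => ENNReal.ofReal (p x) * ∏ i : Fin k,
      ENNReal.ofReal (p (x + (Fin.tail (regularAngles (k + 1)) + s • y) i))) (𝓝[>] 0)
      (𝓝 (ENNReal.ofReal (p x) *
        ∏ i : Fin k, ENNReal.ofReal (p (x + regularAngles (k + 1) i.succ)))) := by
    have hc : Continuous fun s : ℝ => p x * ∏ i : Fin k,
        p (x + (Fin.tail (regularAngles (k + 1)) + s • y) i) :=
      continuous_const.mul (continuous_finsetProd _ fun i _ => hp.continuous.comp (by fun_prop))
    have h := ENNReal.tendsto_ofReal ((hc.tendsto 0).mono_left (nhdsWithin_le_nhds (s := Ioi 0)))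
    have e : ∀ v : Fin k → ℝ, ENNReal.ofReal (p x) * ∏ i, ENNReal.ofReal (p (x + v i)) =
        ENNReal.ofReal (p x * ∏ i, p (x + v i)) := fun v => by
      rw [ENNReal.ofReal_mul (hp.nonneg x),
        ENNReal.ofReal_prod_of_nonneg fun i _ => hp.nonneg _]
    rw [zero_smul, add_zero] at h
    simp_rw [e]
    exact (e fun i => regularAngles (k + 1) i.succ) ▸ h
  rcases lt_or_gt_of_ne hy with hlt | hgt
  · rw [indicator_of_mem (show y ∈ {y : Fin k → ℝ | y ⬝ᵥ (negHessian g k *ᵥ y) < 2} from hlt),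
      Pi.one_apply, mul_one]
    refine hden.congr' ?_
    filter_upwards [hdef.eventually (gt_mem_nhds (show y ⬝ᵥ (negHessian g k *ᵥ y) / 2 < 1 by
      linarith)), eventually_rescaled_box y, self_mem_nhdsWithin] with s h1 h2 h3
    have h3 : 0 < s := h3
    rw [rescaledDensity, indicator_of_mem]
    refine ⟨⟨h2.1, ?_⟩, h2.2⟩
    rw [div_lt_one (by positivity)] at h1
    rw [cons_regularAngles_add_smul]
    exact h1.le
  · rw [indicator_of_notMem (show y ∉ {y : Fin k → ℝ | y ⬝ᵥ (negHessian g k *ᵥ y) < 2} from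
      fun h => lt_asymm h hgt), mul_zero]
    refine tendsto_const_nhds.congr' ?_
    filter_upwards [hdef.eventually (lt_mem_nhds (show 1 < y ⬝ᵥ (negHessian g k *ᵥ y) / 2 by
      linarith)), self_mem_nhdsWithin] with s h1 h3
    have h3 : 0 < s := h3
    rw [rescaledDensity, indicator_of_notMem, mul_zero]
    rintro ⟨⟨-, h2⟩, -⟩
    rw [one_lt_div (by positivity)] at h1
    dsimp only at h2
    rw [cons_regularAngles_add_smul] at h2
    exact absurd h1 (not_lt.2 h2)

theorem lintegral_prod_density (hp : IsContinuousCircleDensity p) :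
    ∫⁻ x in Ico 0 (2 * π), (ENNReal.ofReal (p x) *
      ∏ i : Fin k, ENNReal.ofReal (p (x + regularAngles (k + 1) i.succ))) =
    ENNReal.ofReal (densityIntegral p (k + 1)) := by
  have e : ∀ x, ENNReal.ofReal (p x) *
      ∏ i : Fin k, ENNReal.ofReal (p (x + regularAngles (k + 1) i.succ)) =
      ENNReal.ofReal (∏ l ∈ Finset.range (k + 1),
        p (x + 2 * π * (l : ℝ) / ((k + 1 : ℕ) : ℝ))) := by
    intro x
    rw [← Fin.prod_univ_eq_prod_range fun l : ℕ => p (x + 2 * π * (l : ℝ) / ((k + 1 : ℕ) : ℝ)),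
      Fin.prod_univ_succ, ENNReal.ofReal_mul (hp.nonneg _),
      ENNReal.ofReal_prod_of_nonneg fun i _ => hp.nonneg _]
    simp [regularAngles]
  have hc : Continuous fun x => ∏ l ∈ Finset.range (k + 1),
      p (x + 2 * π * (l : ℝ) / ((k + 1 : ℕ) : ℝ)) :=
    continuous_finsetProd _ fun i _ => hp.continuous.comp (by fun_prop)
  simp_rw [e]
  rw [setLIntegral_congr Ico_ae_eq_Ioc, ← ofReal_integral_eq_lintegral_ofReal,
    ← intervalIntegral.integral_of_le two_pi_pos.le, densityIntegral]
  · exact hc.integrableOn_Ioc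
  · exact Eventually.of_forall fun x => Finset.prod_nonneg fun i _ => hp.nonneg _

/-- Dominated convergence, with the constant P^(k+1) on a fixed ball as majorant. The limit
integrand splits into a function of x times the indicator of the ellipsoid. -/
theorem tendsto_lintegral_rescaledDensity (hg : IsAdmissible g (k + 1))
    (hG : (matrixG g (k + 1)).det ≠ 0) (hp : IsContinuousCircleDensity p) :
    Tendsto (fun s => ∫⁻ z, rescaledDensity g p k s z
        ∂((volume.restrict (Ico 0 (2 * π))).prod volume)) (𝓝[>] 0)
      (𝓝 (ENNReal.ofReal (densityIntegral p (k + 1)) *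
        volume {y : Fin k → ℝ | y ⬝ᵥ (negHessian g k *ᵥ y) < 2})) := by
  obtain ⟨c, hc, hgrow⟩ := exists_growth hg hG
  obtain ⟨P, hP0, hP⟩ := hp.exists_bound
  have hq : Continuous fun y : Fin k → ℝ => y ⬝ᵥ (negHessian g k *ᵥ y) := by
    simp only [dotProduct, mulVec]; fun_prop
  have hE : MeasurableSet {y : Fin k → ℝ | y ⬝ᵥ (negHessian g k *ᵥ y) < 2} :=
    measurableSet_lt hq.measurable measurable_const
  have hmx : Measurable fun x => ENNReal.ofReal (p x) *
      ∏ i : Fin k, ENNReal.ofReal (p (x + regularAngles (k + 1) i.succ)) :=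
    hp.measurable_ofReal.mul
      ((measurable_prod_density hp).comp (measurable_id.prodMk measurable_const))
  have hlim := lintegral_prod_mul (μ := volume.restrict (Ico 0 (2 * π)))
    (ν := (volume : Measure (Fin k → ℝ))) hmx.aemeasurable
    (((measurable_one (α := ENNReal)).indicator hE).aemeasurable)
  rw [lintegral_prod_density hp, lintegral_indicator_one hE] at hlim
  rw [← hlim]
  set Pe : ENNReal := ENNReal.ofReal P
  refine tendsto_lintegral_filter_of_dominated_convergence
    (fun z => ((univ : Set ℝ) ×ˢ Metric.closedBall (0 : Fin k → ℝ) √(1 / c)).indicator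
      (fun _ => Pe * Pe ^ k) z) ?_ ?_ ?_ ?_
  · exact Eventually.of_forall fun s => measurable_rescaledDensity hg.cont hp s
  · filter_upwards [self_mem_nhdsWithin] with s hs
    refine Eventually.of_forall fun z => ?_
    have hs : 0 < s := hs
    rw [rescaledDensity]
    by_cases hz : Fin.tail (regularAngles (k + 1)) + s • z.2 ∈
        nearMaximal g k (s ^ 2) ∩ {β | StrictMono β}
    · rw [indicator_of_mem hz, indicator_of_mem]
      · refine mul_le_mul' (ENNReal.ofReal_le_ofReal (hP _)) ?_
        calc _ ≤ ∏ _i : Fin k, Pe := Finset.prod_le_prod' fun i _ =>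
              ENNReal.ofReal_le_ofReal (hP _)
          _ = Pe ^ k := by simp
      · exact ⟨trivial, by
          rw [mem_closedBall_zero_iff]; exact norm_le_of_rescaled_mem hc hgrow hs hz⟩
    · rw [indicator_of_notMem hz, mul_zero]
      exact zero_le
  · rw [lintegral_indicator_const (MeasurableSet.univ.prod Metric.isClosed_closedBall.measurableSet),
      Measure.prod_prod]
    refine ENNReal.mul_ne_top (ENNReal.mul_ne_top ENNReal.ofReal_ne_top
      (ENNReal.pow_ne_top ENNReal.ofReal_ne_top)) (ENNReal.mul_ne_top ?_ ?_)
    · rw [Measure.restrict_apply_univ, Real.volume_Ico]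
      exact ENNReal.ofReal_ne_top
    · exact measure_closedBall_lt_top.ne
  · have h0 : ∀ᵐ y : Fin k → ℝ, y ⬝ᵥ (negHessian g k *ᵥ y) ≠ 2 := by
      rw [ae_iff]
      simpa using volume_quadratic_eq_two (negHessian_posDef hg hG)
    have h1 : ∀ᵐ z : ℝ × (Fin k → ℝ) ∂((volume.restrict (Ico 0 (2 * π))).prod volume),
        z.2 ⬝ᵥ (negHessian g k *ᵥ z.2) ≠ 2 := Measure.quasiMeasurePreserving_snd.ae h0
    filter_upwards [h1] with z hz
    exact tendsto_rescaledDensity hg hp z.1 hz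

/-- The probability of a deficit at most `s ^ 2` is asymptotic to `k! K s ^ k`. -/
theorem tendsto_deficit_probability (hk : 0 < k) (hg : IsAdmissible g (k + 1))
    (hG : (matrixG g (k + 1)).det ≠ 0) (hp : IsContinuousCircleDensity p) :
    Tendsto (fun s => (Measure.pi fun _ : Fin (k + 1) => circleLaw p).real
        {u | maxValue g (k + 1) - pairKernel g u ≤ s ^ 2} / s ^ k) (𝓝[>] 0)
      (𝓝 ((Nat.factorial k : ℝ) * constK g p (k + 1))) := by
  have hI0 : 0 ≤ densityIntegral p (k + 1) := intervalIntegral.integral_nonneg two_pi_pos.le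
    fun x _ => Finset.prod_nonneg fun i _ => hp.nonneg _
  have hdet : (negHessian g k).det = (-matrixG g (k + 1)).det := rfl
  have hdetpos := (negHessian_posDef hg hG).det_pos
  have hΓ : 0 < Real.Gamma ((k : ℝ) / 2 + 1) := Real.Gamma_pos_of_pos (by positivity)
  have hK : densityIntegral p (k + 1) * ((2 * π) ^ ((k : ℝ) / 2) /
      (√(negHessian g k).det * Real.Gamma ((k : ℝ) / 2 + 1))) = constK g p (k + 1) := by
    rw [constK, ← hdet]
    push_cast
    rw [show ((k : ℝ) + 1 - 1) / 2 = k / 2 by ring, show ((k : ℝ) + 1 + 1) / 2 = k / 2 + 1 by ring]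
    ring
  have h := tendsto_lintegral_rescaledDensity hg hG hp
  rw [volume_quadratic_lt_two hk (negHessian_posDef hg hG), ← ENNReal.ofReal_mul hI0, hK] at h
  have hK0 : 0 ≤ constK g p (k + 1) := by
    rw [← hK]; positivity
  have h2 := ((ENNReal.tendsto_toReal ENNReal.ofReal_ne_top).comp h).const_mul
    (Nat.factorial k : ℝ)
  rw [ENNReal.toReal_ofReal hK0] at h2
  refine h2.congr' ?_
  filter_upwards [self_mem_nhdsWithin] with s hs
  have hs : 0 < s := hs
  rw [Measure.real, pi_circleLaw_deficit_le hg.cont hp hs, ENNReal.toReal_mul, ENNReal.toReal_mul,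
    ENNReal.toReal_ofReal (by positivity), ENNReal.toReal_natCast, Function.comp_apply]
  field_simp

end Asymptotics

/-! ### Simultaneous small deficit of overlapping tuples -/

section Overlap

theorem centralAngle_eq_sub (z₀ z w : Circle) : centralAngle z w =
    toIcoMod two_pi_pos 0 (centralAngle z₀ w - centralAngle z₀ z) := by
  obtain ⟨x, rfl⟩ : ∃ x : ℝ, Circle.exp x = z₀ := ⟨_, Circle.exp_arg z₀⟩
  obtain ⟨y, rfl⟩ : ∃ y : ℝ, Circle.exp y = z := ⟨_, Circle.exp_arg z⟩
  obtain ⟨θ, rfl⟩ : ∃ θ : ℝ, Circle.exp θ = w := ⟨_, Circle.exp_arg w⟩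
  rw [centralAngle_exp, centralAngle_exp, centralAngle_exp,
    ← self_sub_toIcoDiv_zsmul two_pi_pos 0 (θ - x), ← self_sub_toIcoDiv_zsmul two_pi_pos 0 (y - x)]
  set a := toIcoDiv two_pi_pos 0 (θ - x)
  set b := toIcoDiv two_pi_pos 0 (y - x)
  rw [show θ - x - a • (2 * π) - (y - x - b • (2 * π)) = θ - y - (a - b) • (2 * π) by
    rw [sub_smul]; ring, toIcoMod_sub_zsmul]

theorem centralAngle_cases (z₀ z w : Circle) :
    centralAngle z w = centralAngle z₀ w - centralAngle z₀ z ∨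
      centralAngle z w = centralAngle z₀ w - centralAngle z₀ z + 2 * π := by
  rw [centralAngle_eq_sub z₀ z w]
  have h1 := centralAngle_mem z₀ w
  have h2 := centralAngle_mem z₀ z
  rcases le_or_gt 0 (centralAngle z₀ w - centralAngle z₀ z) with h | h
  · left
    rw [toIcoMod_eq_self]
    exact ⟨h, by linarith [h1.2, h2.1]⟩
  · right
    rw [← toIcoMod_add_right, toIcoMod_eq_self]
    exact ⟨by linarith [h1.1, h2.2], by linarith⟩

/-- The angle from `z` to `w` is within `δ` of a multiple of `2π/m`. -/
def NearRegular (m : ℕ) (δ : ℝ) (z w : Circle) : Prop :=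
  ∃ s ∈ Finset.Icc (-(m : ℤ)) (2 * m), |centralAngle z w - 2 * π * (s : ℝ) / m| ≤ δ

/-- After sorting, growth puts each angle within √(ε/c) of its vertex, so differences are off by at
most twice that. -/
theorem nearRegular_of_deficit_le {g : ℝ → ℝ} {k : ℕ} {c ε : ℝ} (hc : 0 < c)
    (hgrow : ∀ β : Fin (k + 1) → ℝ, Monotone β → β 0 = 0 → (∀ i, β i ∈ Icc 0 (2 * π)) →
      c * ‖β - regularAngles (k + 1)‖ ^ 2 ≤ maxValue g (k + 1) - pairSum g β)
    {u : Fin (k + 1) → Circle} (hu : maxValue g (k + 1) - pairKernel g u ≤ ε)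
    (i j : Fin (k + 1)) : NearRegular (k + 1) (2 * √(ε / c)) (u i) (u j) := by
  set β := angleFromFirst u with hβ
  set σ := Tuple.sort β
  have hI : ∀ i, β i ∈ Ico 0 (2 * π) := fun i => centralAngle_mem _ _
  have hmono : Monotone (β ∘ σ) := Tuple.monotone_sort β
  have hβ0 : β 0 = 0 := centralAngle_self _
  have h0 : (β ∘ σ) 0 = 0 := by
    refine le_antisymm ?_ (hI _).1
    have := hmono (Fin.zero_le (σ.symm 0))
    rwa [Function.comp_apply, Function.comp_apply, σ.apply_symm_apply, hβ0] at this
  have h1 := hgrow _ hmono h0 fun i => ⟨(hI _).1, (hI _).2.le⟩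
  rw [pairSum_comp_perm] at h1
  have h2 : ‖β ∘ σ - regularAngles (k + 1)‖ ≤ √(ε / c) := by
    refine Real.le_sqrt_of_sq_le ?_
    rw [le_div_iff₀ hc]
    have : maxValue g (k + 1) - pairSum g β ≤ ε := hu
    linarith
  have h3 : ∀ a, |β (σ a) - regularAngles (k + 1) a| ≤ √(ε / c) := fun a =>
    (norm_le_pi_norm (β ∘ σ - regularAngles (k + 1)) a).trans h2
  obtain ⟨a, rfl⟩ := σ.surjective i
  obtain ⟨b, rfl⟩ := σ.surjective j
  have ha := abs_le.1 (h3 a)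
  have hb := abs_le.1 (h3 b)
  have hab := regularAngles_sub b a
  have ha2 := a.2
  have hb2 := b.2
  have hm : ((k + 1 : ℕ) : ℝ) ≠ 0 := by positivity
  rcases centralAngle_cases (u 0) (u (σ a)) (u (σ b)) with h | h
  · refine ⟨(b : ℕ) - (a : ℕ), ?_, ?_⟩
    · rw [Finset.mem_Icc]; omega
    · rw [h]
      push_cast at hab ⊢
      rw [← hab]
      change |β (σ b) - β (σ a) - _| ≤ _
      exact abs_le.2 ⟨by linarith [ha.2, hb.1], by linarith [ha.1, hb.2]⟩
  -- Passing the base point adds a full turn, that is k + 1 steps of 2π/(k + 1).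
  · refine ⟨(b : ℕ) - (a : ℕ) + (k + 1 : ℕ), ?_, ?_⟩
    · rw [Finset.mem_Icc]; omega
    · rw [h]
      have e : 2 * π * ((((b : ℕ) - (a : ℕ) + (k + 1 : ℕ) : ℤ)) : ℝ) / ((k + 1 : ℕ) : ℝ) =
          regularAngles (k + 1) b - regularAngles (k + 1) a + 2 * π := by
        rw [hab]
        push_cast at hm ⊢
        field_simp
      rw [e]
      change |β (σ b) - β (σ a) + 2 * π - _| ≤ _
      exact abs_le.2 ⟨by linarith [ha.2, hb.1], by linarith [ha.1, hb.2]⟩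

theorem setOf_exists_finset_eq_biUnion (m : ℕ) (δ : ℝ) :
    {β : ℝ | ∃ s ∈ Finset.Icc (-(m : ℤ)) (2 * m), |β - 2 * π * (s : ℝ) / m| ≤ δ} =
      ⋃ s ∈ Finset.Icc (-(m : ℤ)) (2 * m), Metric.closedBall (2 * π * (s : ℝ) / m) δ := by
  ext β
  simp only [mem_ofPred_eq, mem_iUnion, Metric.mem_closedBall, Real.dist_eq, exists_prop]

theorem measurableSet_near_multiples (m : ℕ) (δ : ℝ) : MeasurableSet
    {β : ℝ | ∃ s ∈ Finset.Icc (-(m : ℤ)) (2 * m), |β - 2 * π * (s : ℝ) / m| ≤ δ} := by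
  rw [setOf_exists_finset_eq_biUnion]
  exact Finset.measurableSet_biUnion _ fun s _ => Metric.isClosed_closedBall.measurableSet

section

attribute [local irreducible] centralAngle

theorem measurableSet_nearRegular (m : ℕ) (δ : ℝ) :
    MeasurableSet {q : Circle × Circle | NearRegular m δ q.1 q.2} :=
  measurable_centralAngle (measurableSet_near_multiples m δ)

/-- A union bound over 3m + 1 intervals of length 2δ. Uniformity in z allows conditioning on a
common point. -/
theorem circleLaw_nearRegular_le {p : ℝ → ℝ} (hp : IsContinuousCircleDensity p) {P : ℝ}
    (hP0 : 0 ≤ P) (hP : ∀ x, p x ≤ P) (m : ℕ) (δ : ℝ) (z : Circle) :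
    circleLaw p {w | NearRegular m δ z w} ≤ ENNReal.ofReal ((3 * m + 1) * P * (2 * δ)) := by
  obtain ⟨x, rfl⟩ : ∃ x : ℝ, Circle.exp x = z := ⟨_, Circle.exp_arg z⟩
  have hcA : Measurable (centralAngle (Circle.exp x)) :=
    measurable_centralAngle.comp (measurable_const.prodMk measurable_id)
  have e : circleLaw p {w | NearRegular m δ (Circle.exp x) w} =
      ((circleLaw p).map (centralAngle (Circle.exp x)))
        {β : ℝ | ∃ s ∈ Finset.Icc (-(m : ℤ)) (2 * m), |β - 2 * π * (s : ℝ) / m| ≤ δ} := by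
    rw [Measure.map_apply hcA (measurableSet_near_multiples m δ)]
    rfl
  rw [e, map_centralAngle_circleLaw hp, setOf_exists_finset_eq_biUnion]
  refine (measure_biUnion_finset_le _ _).trans ?_
  have hs : ∀ s ∈ Finset.Icc (-(m : ℤ)) (2 * m),
      ((volume.restrict (Ico (0 : ℝ) (2 * π))).withDensity fun β => ENNReal.ofReal (p (x + β)))
        (Metric.closedBall (2 * π * (s : ℝ) / m) δ) ≤ ENNReal.ofReal (P * (2 * δ)) := by
    intro s _
    rw [withDensity_apply _ Metric.isClosed_closedBall.measurableSet]
    calc _ ≤ ∫⁻ _ in Metric.closedBall (2 * π * (s : ℝ) / m) δ, ENNReal.ofReal P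
          ∂(volume.restrict (Ico (0 : ℝ) (2 * π))) :=
          lintegral_mono fun β => ENNReal.ofReal_le_ofReal (hP _)
      _ ≤ ∫⁻ _ in Metric.closedBall (2 * π * (s : ℝ) / m) δ, ENNReal.ofReal P :=
          lintegral_mono' (Measure.restrict_mono le_rfl Measure.restrict_le_self) le_rfl
      _ = ENNReal.ofReal (P * (2 * δ)) := by
          rw [setLIntegral_const, Real.volume_closedBall, ENNReal.ofReal_mul hP0]
  refine (Finset.sum_le_sum hs).trans ?_
  rw [Finset.sum_const, nsmul_eq_mul, Int.card_Icc, ← ENNReal.ofReal_natCast,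
    ← ENNReal.ofReal_mul (by positivity)]
  refine ENNReal.ofReal_le_ofReal ?_
  have : ((2 * (m : ℤ) + 1 - -(m : ℤ)).toNat : ℝ) = 3 * m + 1 := by
    rw [show (2 * (m : ℤ) + 1 - -(m : ℤ)).toNat = 3 * m + 1 by omega]
    push_cast; ring
  rw [this, mul_assoc]

end

variable {Ω : Type*} [MeasurableSpace Ω] {μ : Measure Ω} [IsProbabilityMeasure μ]

/-- The law of finitely many members of an i.i.d. sequence. -/
theorem map_sample_eq_pi {X : Type*} [MeasurableSpace X] {U : ℕ → Ω → X} {ν : Measure X}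
    (hU : ∀ i, Measurable (U i)) (hind : iIndepFun U μ) (hlaw : ∀ i, μ.map (U i) = ν) {n : ℕ}
    {f : Fin n → ℕ} (hf : Function.Injective f) :
    μ.map (fun ω i => U (f i) ω) = Measure.pi fun _ : Fin n => ν := by
  have h := (iIndepFun_iff_map_fun_eq_pi_map fun i => (hU (f i)).aemeasurable).1 (hind.precomp hf)
  simpa only [hlaw] using h

/-- Given the value of U j₀, the conditions on the other points are independent, each of probability
at most κ. -/
theorem prob_forall_rel_le {X : Type*} [MeasurableSpace X] {U : ℕ → Ω → X} {ν : Measure X}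
    [IsProbabilityMeasure ν] (hU : ∀ i, Measurable (U i)) (hind : iIndepFun U μ)
    (hlaw : ∀ i, μ.map (U i) = ν) {D : Set (X × X)} (hD : MeasurableSet D) {κ : ENNReal}
    (hκ : ∀ z, ν {w | (z, w) ∈ D} ≤ κ) {j₀ : ℕ} {T : Finset ℕ} (hj₀ : j₀ ∉ T) :
    μ {ω | ∀ j ∈ T, (U j₀ ω, U j ω) ∈ D} ≤ κ ^ T.card := by
  set f : Fin (T.card + 1) → ℕ := Fin.cons j₀ (T.orderEmbOfFin rfl) with hfdef
  have hf : Function.Injective f := by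
    rw [hfdef, Fin.cons_injective_iff]
    refine ⟨?_, (T.orderEmbOfFin rfl).injective⟩
    rwa [Finset.range_orderEmbOfFin, Finset.mem_coe]
  set B : Set (X × (Fin T.card → X)) := {q | ∀ i, (q.1, q.2 i) ∈ D} with hB
  have hBm : MeasurableSet B := by
    have : B = ⋂ i, (fun q : X × (Fin T.card → X) => (q.1, q.2 i)) ⁻¹' D := by
      ext q; simp [hB]
    rw [this]
    exact MeasurableSet.iInter fun i => hD.preimage
      (measurable_fst.prodMk ((measurable_pi_apply i).comp measurable_snd))
  have hmp := measurePreserving_piFinSuccAbove (fun _ : Fin (T.card + 1) => ν) 0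
  have hm : Measurable fun ω i => U (f i) ω := measurable_pi_lambda _ fun i => hU (f i)
  have e : {ω | ∀ j ∈ T, (U j₀ ω, U j ω) ∈ D} = (fun ω i => U (f i) ω) ⁻¹'
      ((MeasurableEquiv.piFinSuccAbove (fun _ => X) 0) ⁻¹' B) := by
    ext ω
    constructor
    · intro h i
      exact h _ (Finset.orderEmbOfFin_mem T rfl i)
    · intro h j hj
      have : j ∈ Set.range (T.orderEmbOfFin rfl) := by
        rwa [Finset.range_orderEmbOfFin, Finset.mem_coe]
      obtain ⟨i, rfl⟩ := this
      exact h i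
  rw [e, ← Measure.map_apply hm (hmp.measurable hBm), map_sample_eq_pi hU hind hlaw hf,
    hmp.measure_preimage hBm.nullMeasurableSet, Measure.prod_apply hBm]
  calc _ ≤ ∫⁻ _, κ ^ T.card ∂ν := by
        refine lintegral_mono fun z => ?_
        have : Prod.mk z ⁻¹' B = univ.pi fun _ : Fin T.card => {w | (z, w) ∈ D} := by
          ext q; simp [hB]
        simp only [this]
        rw [Measure.pi_pi]
        calc _ ≤ ∏ _i : Fin T.card, κ := Finset.prod_le_prod' fun i _ => hκ z
          _ = κ ^ T.card := by simp
    _ = κ ^ T.card := by simp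

end Overlap

/-! ### Weighted counts of subsets and of pairs of subsets -/

section Counting

/-- There are at most n^v subsets of size v, so each size contributes at most 1. -/
theorem sum_inv_pow_card_le {n : ℕ} (hn : 0 < n) (N : ℕ) :
    ∑ S ∈ (Finset.range n).powerset with S.card ≤ N, ((n : ℝ) ^ S.card)⁻¹ ≤ N + 1 := by
  have hn' : (0 : ℝ) < n := by exact_mod_cast hn
  rw [← Finset.sum_fiberwise_of_maps_to (t := Finset.range (N + 1)) (g := Finset.card)
    (fun S hS => by
      rw [Finset.mem_filter] at hS
      exact Finset.mem_range.2 (Nat.lt_succ_of_le hS.2))]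
  calc _ ≤ ∑ v ∈ Finset.range (N + 1), (1 : ℝ) := by
        refine Finset.sum_le_sum fun v _ => ?_
        calc _ ≤ ∑ S ∈ Finset.powersetCard v (Finset.range n), ((n : ℝ) ^ v)⁻¹ := by
              rw [Finset.sum_congr rfl (g := fun _ => ((n : ℝ) ^ v)⁻¹) fun S hS => by
                rw [(Finset.mem_filter.1 hS).2]]
              refine Finset.sum_le_sum_of_subset_of_nonneg (fun S hS => ?_)
                fun _ _ _ => by positivity
              simp only [Finset.mem_filter, Finset.mem_powerset] at hS
              exact Finset.mem_powersetCard.2 ⟨hS.1.1, hS.2⟩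
          _ = (n.choose v : ℝ) * ((n : ℝ) ^ v)⁻¹ := by
              rw [Finset.sum_const, Finset.card_powersetCard, Finset.card_range, nsmul_eq_mul]
          _ ≤ 1 := by
              rw [← div_eq_mul_inv, div_le_one (by positivity)]
              exact_mod_cast Nat.choose_le_pow n v
    _ = N + 1 := by simp

/-- Pairs of `m`-subsets, weighted by the size of their union. -/
theorem sum_pairs_inv_pow_card_union_le {n : ℕ} (hn : 0 < n) (m : ℕ) :
    ∑ J ∈ Finset.powersetCard m (Finset.range n), ∑ K ∈ Finset.powersetCard m (Finset.range n),
      ((n : ℝ) ^ (J ∪ K).card)⁻¹ ≤ 4 ^ (2 * m) * (2 * m + 1) := by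
  set T := Finset.powersetCard m (Finset.range n)
  set V := (Finset.range n).powerset.filter fun S => S.card ≤ 2 * m
  rw [← Finset.sum_product']
  rw [← Finset.sum_fiberwise_of_maps_to (t := V) (g := fun q : Finset ℕ × Finset ℕ => q.1 ∪ q.2)
    (fun q hq => by
      obtain ⟨h1, h2⟩ := Finset.mem_product.1 hq
      obtain ⟨h1, h3⟩ := Finset.mem_powersetCard.1 h1
      obtain ⟨h2, h4⟩ := Finset.mem_powersetCard.1 h2
      refine Finset.mem_filter.2 ⟨Finset.mem_powerset.2 (Finset.union_subset h1 h2), ?_⟩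
      have := Finset.card_union_le q.1 q.2
      omega)]
  calc _ ≤ ∑ S ∈ V, 4 ^ (2 * m) * ((n : ℝ) ^ S.card)⁻¹ := by
        refine Finset.sum_le_sum fun S hS => ?_
        -- Both members of a pair with union S are subsets of S, which leaves at most 2^|S| · 2^|S|
        -- pairs.
        have hc : ((T ×ˢ T).filter fun q : Finset ℕ × Finset ℕ => q.1 ∪ q.2 = S).card ≤
            4 ^ (2 * m) := by
          calc _ ≤ (S.powerset ×ˢ S.powerset).card := by
                refine Finset.card_le_card fun q hq => ?_
                have hq := (Finset.mem_filter.1 hq).2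
                rw [Finset.mem_product, Finset.mem_powerset, Finset.mem_powerset, ← hq]
                exact ⟨Finset.subset_union_left, Finset.subset_union_right⟩
            _ = 4 ^ S.card := by
                rw [Finset.card_product, Finset.card_powerset, ← mul_pow]; norm_num
            _ ≤ 4 ^ (2 * m) := Nat.pow_le_pow_right (by norm_num) (Finset.mem_filter.1 hS).2
        rw [Finset.sum_congr rfl (g := fun _ => ((n : ℝ) ^ S.card)⁻¹) fun q hq => by
          rw [(Finset.mem_filter.1 hq).2], Finset.sum_const, nsmul_eq_mul]
        refine mul_le_mul_of_nonneg_right ?_ (by positivity)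
        exact_mod_cast hc
    _ ≤ 4 ^ (2 * m) * (2 * m + 1) := by
        rw [← Finset.mul_sum]
        refine mul_le_mul_of_nonneg_left ?_ (by positivity)
        have := sum_inv_pow_card_le hn (2 * m)
        push_cast at this
        exact this

end Counting

/-! ### Poisson approximation for the number of tuples of small deficit -/

section Main

variable {Ω : Type*} [MeasurableSpace Ω] {μ : Measure Ω} [IsProbabilityMeasure μ]
variable {U : ℕ → Ω → Circle} {g p : ℝ → ℝ} {k : ℕ}

/-- The sequences whose points with index in `J` form an `m`-tuple of deficit at most `ε`. -/
def tupleEvent (g : ℝ → ℝ) (k : ℕ) (ε : ℝ) (J : Finset ℕ) : Set (ℕ → Circle) :=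
  {x | ∃ h : J.card = k + 1,
    maxValue g (k + 1) - pairKernel g (fun i => x (J.orderEmbOfFin h i)) ≤ ε}

theorem tupleEvent_eq (g : ℝ → ℝ) (ε : ℝ) {J : Finset ℕ} (h : J.card = k + 1) :
    tupleEvent g k ε J = (fun x i => x (J.orderEmbOfFin h i)) ⁻¹'
      {u : Fin (k + 1) → Circle | maxValue g (k + 1) - pairKernel g u ≤ ε} := by
  ext x
  exact ⟨fun ⟨_, hx⟩ => hx, fun hx => ⟨h, hx⟩⟩

theorem measurableSet_deficit_le (hg : ContinuousOn g (Icc 0 (2 * π))) (ε : ℝ) :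
    MeasurableSet {u : Fin (k + 1) → Circle | maxValue g (k + 1) - pairKernel g u ≤ ε} :=
  measurableSet_le (measurable_const.sub (measurable_pairKernel hg)) measurable_const

theorem measurableSet_tupleEvent (hg : ContinuousOn g (Icc 0 (2 * π))) (ε : ℝ) (J : Finset ℕ) :
    MeasurableSet (tupleEvent g k ε J) := by
  by_cases h : J.card = k + 1
  · rw [tupleEvent_eq g ε h]
    exact (measurableSet_deficit_le hg ε).preimage
      (measurable_pi_lambda _ fun i => measurable_pi_apply _)
  · have : tupleEvent g k ε J = ∅ := by
      ext x; simp [tupleEvent, h]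
    rw [this]; exact MeasurableSet.empty

theorem tupleEvent_congr (g : ℝ → ℝ) (ε : ℝ) {J : Finset ℕ} {x y : ℕ → Circle}
    (hxy : ∀ i ∈ J, x i = y i) : x ∈ tupleEvent g k ε J ↔ y ∈ tupleEvent g k ε J := by
  have e : ∀ h : J.card = k + 1,
      (fun i => x (J.orderEmbOfFin h i)) = fun i => y (J.orderEmbOfFin h i) := fun h =>
    funext fun i => hxy _ (Finset.orderEmbOfFin_mem J h i)
  simp only [tupleEvent, mem_ofPred_eq, e]

/-- The indicator of `tupleEvent`, as a function on the probability space. -/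
noncomputable def tupleIndicator (U : ℕ → Ω → Circle) (g : ℝ → ℝ) (k : ℕ) (ε : ℝ) (J : Finset ℕ)
    (ω : Ω) : ℕ :=
  (tupleEvent g k ε J).indicator 1 fun i => U i ω

theorem measurable_tupleIndicator (hU : ∀ i, Measurable (U i))
    (hg : ContinuousOn g (Icc 0 (2 * π))) (ε : ℝ) (J : Finset ℕ) :
    Measurable (tupleIndicator U g k ε J) :=
  ((measurable_one (α := ℕ)).indicator (measurableSet_tupleEvent hg ε J)).comp
    (measurable_pi_lambda _ hU)

theorem tupleIndicator_le_one {Ω : Type*} {U : ℕ → Ω → Circle} (ε : ℝ) (J : Finset ℕ) (ω : Ω) :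
    tupleIndicator U g k ε J ω ≤ 1 :=
  indicator_le_self' (fun _ _ => zero_le) _

/-- Each indicator depends only on the points indexed by its set, and the blocks J and ⋃ A are
disjoint. -/
theorem indepFun_tupleIndicator {μ : Measure Ω} (hU : ∀ i, Measurable (U i)) (hind : iIndepFun U μ)
    (hg : ContinuousOn g (Icc 0 (2 * π))) (ε : ℝ) {J : Finset ℕ} {A : Finset (Finset ℕ)}
    (hA : ∀ K ∈ A, Disjoint J K) :
    IndepFun (tupleIndicator U g k ε J) (fun ω => ∑ K ∈ A, tupleIndicator U g k ε K ω) μ := by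
  classical
  set S := A.biUnion id
  have hJS : Disjoint J S := (Finset.disjoint_biUnion_right _ _ _).2 hA
  have h := hind.indepFun_finset J S hJS hU
  -- Filling the missing coordinates with 1 exhibits each indicator as a function of finitely many
  -- points.
  set ext : (R : Finset ℕ) → (R → Circle) → ℕ → Circle :=
    fun R x i => if h : i ∈ R then x ⟨i, h⟩ else 1 with hext
  have hextm : ∀ R, Measurable (ext R) := by
    intro R
    refine measurable_pi_lambda _ fun i => ?_
    by_cases h : i ∈ R
    · simpa only [hext, h, dif_pos] using measurable_pi_apply _
    · simpa only [hext, h, dif_neg, not_false_eq_true] using measurable_const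
  have hfac : ∀ (R K : Finset ℕ), K ⊆ R → ∀ ω, tupleIndicator U g k ε K ω =
      (tupleEvent g k ε K).indicator (1 : (ℕ → Circle) → ℕ) (ext R fun i : R => U i ω) := by
    intro R K hKR ω
    have := tupleEvent_congr (k := k) g ε (J := K) (x := fun i => U i ω)
      (y := ext R fun i : R => U i ω) fun i hi => by simp [hext, hKR hi]
    by_cases hx : (fun i => U i ω) ∈ tupleEvent g k ε K
    · rw [tupleIndicator, indicator_of_mem hx, indicator_of_mem (this.1 hx)]; rfl
    · rw [tupleIndicator, indicator_of_notMem hx, indicator_of_notMem fun h => hx (this.2 h)]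
  have hφ : ∀ R K : Finset ℕ, Measurable fun x : R → Circle =>
      (tupleEvent g k ε K).indicator (1 : (ℕ → Circle) → ℕ) (ext R x) := fun R K =>
    ((measurable_one (α := ℕ)).indicator (measurableSet_tupleEvent hg ε K)).comp (hextm R)
  have h2 := h.comp (hφ J J) (Finset.measurable_sum A fun K _ => hφ S K)
  convert h2 using 1
  · funext ω
    exact hfac J J (Finset.Subset.refl J) ω
  · funext ω
    rw [Function.comp_apply]
    refine Finset.sum_congr rfl fun K hK => hfac S K ?_ ω
    exact Finset.subset_biUnion_of_mem id hK

theorem integral_tupleIndicator (hU : ∀ i, Measurable (U i)) (hind : iIndepFun U μ)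
    (hlaw : ∀ i, μ.map (U i) = circleLaw p) (hg : ContinuousOn g (Icc 0 (2 * π))) (ε : ℝ)
    {J : Finset ℕ} (hJ : J.card = k + 1) :
    ∫ ω, (tupleIndicator U g k ε J ω : ℝ) ∂μ =
      (Measure.pi fun _ : Fin (k + 1) => circleLaw p).real
        {u | maxValue g (k + 1) - pairKernel g u ≤ ε} := by
  have hm : Measurable fun ω i => U (J.orderEmbOfFin hJ i) ω :=
    measurable_pi_lambda _ fun i => hU _
  have hS := measurableSet_deficit_le (k := k) hg ε
  have e : ∀ ω, (tupleIndicator U g k ε J ω : ℝ) =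
      ((fun ω i => U (J.orderEmbOfFin hJ i) ω) ⁻¹'
        {u : Fin (k + 1) → Circle | maxValue g (k + 1) - pairKernel g u ≤ ε}).indicator 1 ω := by
    intro ω
    rw [tupleIndicator, tupleEvent_eq g ε hJ]
    simp only [indicator, mem_preimage]
    split_ifs <;> simp
  simp_rw [e]
  rw [integral_indicator_one (hS.preimage hm), Measure.real, Measure.real,
    ← Measure.map_apply hm hS,
    map_sample_eq_pi hU hind hlaw (J.orderEmbOfFin hJ).injective]

theorem tupleEvent_nearRegular {c ε : ℝ} (hc : 0 < c)
    (hgrow : ∀ β : Fin (k + 1) → ℝ, Monotone β → β 0 = 0 → (∀ i, β i ∈ Icc 0 (2 * π)) →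
      c * ‖β - regularAngles (k + 1)‖ ^ 2 ≤ maxValue g (k + 1) - pairSum g β)
    {J : Finset ℕ} {x : ℕ → Circle} (hx : x ∈ tupleEvent g k ε J) {i j : ℕ} (hi : i ∈ J)
    (hj : j ∈ J) : NearRegular (k + 1) (2 * √(ε / c)) (x i) (x j) := by
  obtain ⟨hJ, hx⟩ := hx
  have hr : ∀ i ∈ J, ∃ a, J.orderEmbOfFin hJ a = i := fun i hi => by
    have : i ∈ Set.range (J.orderEmbOfFin hJ) := by
      rwa [Finset.range_orderEmbOfFin, Finset.mem_coe]
    exact this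
  obtain ⟨a, rfl⟩ := hr i hi
  obtain ⟨b, rfl⟩ := hr j hj
  exact nearRegular_of_deficit_le hc hgrow hx a b

/-- Two overlapping tuples have simultaneously a small deficit only with small probability. -/
theorem integral_mul_tupleIndicator_le (hU : ∀ i, Measurable (U i)) (hind : iIndepFun U μ)
    (hlaw : ∀ i, μ.map (U i) = circleLaw p) (hp : IsContinuousCircleDensity p)
    (hg : ContinuousOn g (Icc 0 (2 * π))) {c ε : ℝ} (hc : 0 < c)
    (hgrow : ∀ β : Fin (k + 1) → ℝ, Monotone β → β 0 = 0 → (∀ i, β i ∈ Icc 0 (2 * π)) →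
      c * ‖β - regularAngles (k + 1)‖ ^ 2 ≤ maxValue g (k + 1) - pairSum g β)
    {κ : ℝ} (hκ0 : 0 ≤ κ)
    (hκ : ∀ z, circleLaw p {w | NearRegular (k + 1) (2 * √(ε / c)) z w} ≤ ENNReal.ofReal κ)
    {J K : Finset ℕ} (hJK : ¬Disjoint J K) :
    ∫ ω, (tupleIndicator U g k ε J ω : ℝ) * tupleIndicator U g k ε K ω ∂μ ≤
      κ ^ ((J ∪ K).card - 1) := by
  have := isProbabilityMeasure_circleLaw hp
  obtain ⟨j₀, hjJ, hjK⟩ := Finset.not_disjoint_iff.1 hJK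
  have hUm : Measurable fun ω i => U i ω := measurable_pi_lambda _ hU
  have hS := ((measurableSet_tupleEvent (k := k) hg ε J).inter
    (measurableSet_tupleEvent (k := k) hg ε K)).preimage hUm
  have e : ∀ ω, (tupleIndicator U g k ε J ω : ℝ) * tupleIndicator U g k ε K ω =
      ((fun ω i => U i ω) ⁻¹' (tupleEvent g k ε J ∩ tupleEvent g k ε K)).indicator 1 ω := by
    intro ω
    simp only [tupleIndicator, indicator, mem_preimage, mem_inter_iff]
    split_ifs <;> simp_all
  simp_rw [e]
  rw [integral_indicator_one hS, Measure.real]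
  have hcard : ((J ∪ K).erase j₀).card = (J ∪ K).card - 1 :=
    Finset.card_erase_of_mem (Finset.mem_union_left _ hjJ)
  -- If both events occur, all points of J ∪ K other than U j₀ are in nearly regular position
  -- relative to U j₀, since j₀ lies in both sets.
  have hle := prob_forall_rel_le hU hind hlaw
    (measurableSet_nearRegular (k + 1) (2 * √(ε / c))) hκ
    (Finset.notMem_erase j₀ (J ∪ K))
  rw [hcard, ← ENNReal.ofReal_pow hκ0] at hle
  refine ENNReal.toReal_le_of_le_ofReal (by positivity) ((measure_mono fun ω hω => ?_).trans hle)
  intro j hj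
  rcases Finset.mem_union.1 (Finset.mem_of_mem_erase hj) with h | h
  · exact tupleEvent_nearRegular hc hgrow hω.1 hjJ h
  · exact tupleEvent_nearRegular hc hgrow hω.2 hjK h

/-- Separates the weight n^(-v), summed by counting unions of size v, from an error factor common to
all pairs. -/
theorem pow_le_inv_mul {n : ℕ} (hn : 0 < n) {κ : ℝ} (hκ0 : 0 ≤ κ) (hnκ : n * κ ≤ 1) {v a m : ℕ}
    (hva : v ≤ a + 1) (hma : m ≤ a) :
    κ ^ a ≤ ((n : ℝ) ^ v)⁻¹ * (n * (n * κ) ^ m) := by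
  have hn1 : (1 : ℝ) ≤ n := by exact_mod_cast hn
  have hn0 : (0 : ℝ) < n := by linarith
  rw [← div_eq_inv_mul, le_div_iff₀ (by positivity)]
  calc κ ^ a * (n : ℝ) ^ v ≤ κ ^ a * (n : ℝ) ^ (a + 1) := by gcongr
    _ = n * (n * κ) ^ a := by ring
    _ ≤ n * (n * κ) ^ m := by
        exact mul_le_mul_of_nonneg_left
          (pow_le_pow_of_le_one (by positivity) hnκ hma) hn0.le

/-- The neighbours of J are the index sets meeting J. Both error sums of the Poisson bound are
dominated by the same weighted count of pairs, whence the factor 2. -/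
theorem abs_prob_sub_exp_le (hk : 0 < k) (hU : ∀ i, Measurable (U i)) (hind : iIndepFun U μ)
    (hlaw : ∀ i, μ.map (U i) = circleLaw p) (hp : IsContinuousCircleDensity p)
    (hg : ContinuousOn g (Icc 0 (2 * π))) {c ε : ℝ} (hc : 0 < c)
    (hgrow : ∀ β : Fin (k + 1) → ℝ, Monotone β → β 0 = 0 → (∀ i, β i ∈ Icc 0 (2 * π)) →
      c * ‖β - regularAngles (k + 1)‖ ^ 2 ≤ maxValue g (k + 1) - pairSum g β)
    {κ : ℝ} (hκ0 : 0 ≤ κ)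
    (hκ : ∀ z, circleLaw p {w | NearRegular (k + 1) (2 * √(ε / c)) z w} ≤ ENNReal.ofReal κ)
    {n : ℕ} (hn : 0 < n) (hnκ : n * κ ≤ 1) :
    |μ.real {ω | ∑ J ∈ Finset.powersetCard (k + 1) (Finset.range n),
        tupleIndicator U g k ε J ω = 0} -
      exp (-((n.choose (k + 1) : ℝ) * (Measure.pi fun _ : Fin (k + 1) => circleLaw p).real
        {u | maxValue g (k + 1) - pairKernel g u ≤ ε}))| ≤
      2 * (4 ^ (2 * (k + 1)) * (2 * (k + 1) + 1)) * (n * (n * κ) ^ (k + 1)) := by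
  classical
  set T := Finset.powersetCard (k + 1) (Finset.range n) with hT
  set q := (Measure.pi fun _ : Fin (k + 1) => circleLaw p).real
        {u | maxValue g (k + 1) - pairKernel g u ≤ ε} with hq
  set R : ℝ := n * (n * κ) ^ (k + 1) with hR
  have hR0 : 0 ≤ R := by positivity
  have hTcard : ∀ J ∈ T, J.card = k + 1 := fun J hJ => (Finset.mem_powersetCard.1 hJ).2
  have hint : ∀ J ∈ T, ∫ ω, (tupleIndicator U g k ε J ω : ℝ) ∂μ = q := fun J hJ =>
    integral_tupleIndicator hU hind hlaw hg ε (hTcard J hJ)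
  have hpair : ∀ {J K : Finset ℕ}, ¬Disjoint J K →
      ∫ ω, (tupleIndicator U g k ε J ω : ℝ) * tupleIndicator U g k ε K ω ∂μ ≤
        κ ^ ((J ∪ K).card - 1) := fun h =>
    integral_mul_tupleIndicator_le hU hind hlaw hp hg hc hgrow hκ0 hκ h
  have hq0 : 0 ≤ q := measureReal_nonneg
  have hself : ∀ {J : Finset ℕ}, J ∈ T → ¬Disjoint J J := fun hJ h => by
    have h0 := hTcard _ hJ
    rw [disjoint_self.1 h] at h0
    simp at h0
  -- The square of an indicator is itself, so the pair bound with J = K bounds a single probability.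
  have hqle : ∀ J ∈ T, q ≤ κ ^ k := fun J hJ => by
    have h := hpair (hself hJ)
    rw [Finset.union_self, hTcard J hJ, Nat.add_sub_cancel] at h
    rw [← hint J hJ]
    refine (le_of_eq (integral_congr_ae (Eventually.of_forall fun ω => ?_))).trans h
    have := tupleIndicator_le_one (U := U) (g := g) (k := k) ε J ω
    have h2 : tupleIndicator U g k ε J ω = 0 ∨ tupleIndicator U g k ε J ω = 1 := by omega
    rcases h2 with h2 | h2 <;> simp [h2]
  have hmain := abs_prob_sum_eq_zero_sub_exp_le (μ := μ) T
    (fun J => T.filter fun K => ¬Disjoint J K) (fun J _ => Finset.filter_subset _ _)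
    (fun J hJ => Finset.mem_filter.2 ⟨hJ, hself hJ⟩)
    (tupleIndicator U g k ε) (measurable_tupleIndicator hU hg ε) (tupleIndicator_le_one ε)
    (fun J _ => indepFun_tupleIndicator hU hind hg ε fun K hK => by
      by_contra hJK
      rw [Finset.mem_sdiff] at hK
      exact hK.2 (Finset.mem_filter.2 ⟨hK.1, hJK⟩))
  have hsum : ∑ J ∈ T, ∫ ω, (tupleIndicator U g k ε J ω : ℝ) ∂μ = (n.choose (k + 1) : ℝ) * q := by
    rw [Finset.sum_congr rfl hint, Finset.sum_const, hT, Finset.card_powersetCard,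
      Finset.card_range, nsmul_eq_mul]
  rw [hsum] at hmain
  refine hmain.trans ?_
  have hcount := sum_pairs_inv_pow_card_union_le hn (k + 1)
  push_cast at hcount
  calc _ ≤ ∑ J ∈ T, ∑ K ∈ T, 2 * (((n : ℝ) ^ (J ∪ K).card)⁻¹ * R) := by
        refine Finset.sum_le_sum fun J hJ => ?_
        have hv : ∀ K ∈ T, (J ∪ K).card ≤ 2 * (k + 1) := fun K hK => by
          have := Finset.card_union_le J K
          have := hTcard J hJ
          have := hTcard K hK
          omega
        have hvd : ∀ K ∈ T, ¬Disjoint J K → (J ∪ K).card ≤ 2 * k + 1 := fun K hK h => by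
          have h1 := Finset.card_union_add_card_inter J K
          have h2 : 0 < (J ∩ K).card := Finset.card_pos.2 (Finset.not_disjoint_iff_nonempty_inter.1 h)
          have := hTcard J hJ
          have := hTcard K hK
          omega
        have h1 : ∑ K ∈ T.filter (fun K => ¬Disjoint J K),
            (∫ ω, (tupleIndicator U g k ε J ω : ℝ) ∂μ) *
              (∫ ω, (tupleIndicator U g k ε K ω : ℝ) ∂μ) ≤
            ∑ K ∈ T, ((n : ℝ) ^ (J ∪ K).card)⁻¹ * R := by
          refine (Finset.sum_le_sum fun K hK => ?_).trans
            (Finset.sum_le_sum_of_subset_of_nonneg (Finset.filter_subset _ _)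
              fun _ _ _ => by positivity)
          obtain ⟨hK, hd⟩ := Finset.mem_filter.1 hK
          rw [hint J hJ, hint K hK]
          calc q * q ≤ κ ^ k * κ ^ k :=
                mul_le_mul (hqle J hJ) (hqle J hJ) hq0 (by positivity)
            _ = κ ^ (2 * k) := by ring
            -- Overlap gives |J ∪ K| ≤ 2k + 1, and k + 1 ≤ 2k because k ≥ 1.
            _ ≤ _ := pow_le_inv_mul hn hκ0 hnκ (hvd K hK hd) (by omega)
        have h2 : ∑ K ∈ (T.filter fun K => ¬Disjoint J K).erase J,
            ∫ ω, (tupleIndicator U g k ε J ω : ℝ) * tupleIndicator U g k ε K ω ∂μ ≤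
            ∑ K ∈ T, ((n : ℝ) ^ (J ∪ K).card)⁻¹ * R := by
          refine (Finset.sum_le_sum fun K hK => ?_).trans
            (Finset.sum_le_sum_of_subset_of_nonneg
              ((Finset.erase_subset _ _).trans (Finset.filter_subset _ _))
              fun _ _ _ => by positivity)
          obtain ⟨hne, hK⟩ := Finset.mem_erase.1 hK
          obtain ⟨hK, hd⟩ := Finset.mem_filter.1 hK
          -- Distinct sets of equal size have a strictly larger union, so the exponent |J ∪ K| - 1
          -- is at least k + 1. The extra unit is essential: when κ is proportional to the scale, n
          -- (nκ)^k stays of order 1.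
          have hlt : k + 1 < (J ∪ K).card := by
            by_contra hcon
            have e1 := Finset.eq_of_subset_of_card_le
              (Finset.subset_union_left (s₁ := J) (s₂ := K)) (by rw [hTcard J hJ]; omega)
            have e2 := Finset.eq_of_subset_of_card_le
              (Finset.subset_union_right (s₁ := J) (s₂ := K)) (by rw [hTcard K hK]; omega)
            exact hne (e2.trans e1.symm)
          exact (hpair hd).trans (pow_le_inv_mul hn hκ0 hnκ (by omega) (by omega))
        refine (add_le_add h1 h2).trans (le_of_eq ?_)
        rw [← Finset.mul_sum]
        ring
    _ = 2 * (∑ J ∈ T, ∑ K ∈ T, ((n : ℝ) ^ (J ∪ K).card)⁻¹) * R := by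
        simp only [← Finset.mul_sum, ← Finset.sum_mul]
        ring
    _ ≤ _ := by
        refine mul_le_mul_of_nonneg_right ?_ hR0
        exact mul_le_mul_of_nonneg_left hcount (by norm_num)

/-- The supremum over a finite nonempty family is attained, and order embeddings into `Fin n`
correspond to their images. -/
theorem uMax_deficit_le_iff (g : ℝ → ℝ) (ε : ℝ) {n : ℕ} (hn : k + 1 ≤ n) (x : ℕ → Circle) :
    maxValue g (k + 1) - uMax (pairKernel g (m := k + 1)) n x ≤ ε ↔
      ∃ J ∈ Finset.powersetCard (k + 1) (Finset.range n), x ∈ tupleEvent g k ε J := by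
  have hne : Nonempty (Fin (k + 1) ↪o Fin n) := ⟨Fin.castLEOrderEmb hn⟩
  have h1 : maxValue g (k + 1) - uMax (pairKernel g (m := k + 1)) n x ≤ ε ↔
      ∃ J : Fin (k + 1) ↪o Fin n,
        maxValue g (k + 1) - pairKernel g (fun l => x (J l)) ≤ ε := by
    constructor
    · intro h
      obtain ⟨J, hJ⟩ := exists_eq_ciSup_of_finite
        (f := fun J : Fin (k + 1) ↪o Fin n => pairKernel g (fun l => x (J l)))
      refine ⟨J, ?_⟩
      rw [hJ]; exact h
    · rintro ⟨J, hJ⟩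
      have := le_ciSup (Set.finite_range
        fun J : Fin (k + 1) ↪o Fin n => pairKernel g (fun l => x (J l))).bddAbove J
      exact (sub_le_sub_left this _).trans hJ
  rw [h1]
  constructor
  · rintro ⟨J, hJ⟩
    set f : Fin (k + 1) ↪o ℕ := J.trans (Fin.valOrderEmb n) with hf
    set S : Finset ℕ := Finset.univ.map f.toEmbedding with hS
    have hSc : S.card = k + 1 := by simp [hS]
    refine ⟨S, Finset.mem_powersetCard.2 ⟨fun i hi => ?_, hSc⟩, hSc, ?_⟩
    · obtain ⟨a, -, rfl⟩ := Finset.mem_map.1 hi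
      exact Finset.mem_range.2 (J a).2
    · have := Finset.orderEmbOfFin_unique' hSc (f := f) fun a =>
        Finset.mem_map_of_mem _ (Finset.mem_univ a)
      rw [← this]
      exact hJ
  · rintro ⟨S, hS, hSc, hx⟩
    have hlt : ∀ i, S.orderEmbOfFin hSc i < n := fun i => Finset.mem_range.1
      ((Finset.mem_powersetCard.1 hS).1 (Finset.orderEmbOfFin_mem S hSc i))
    exact ⟨OrderEmbedding.ofStrictMono (fun i => ⟨S.orderEmbOfFin hSc i, hlt i⟩)
      fun i j hij => (S.orderEmbOfFin hSc).strictMono hij, hx⟩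

end Main

/-! ### Powers of n at the critical scale -/

section Scaling

/-- The scale `√t n^(-(k+1)/k)` on which the best configuration among `n` points lives. -/
noncomputable def scale (k : ℕ) (t : ℝ) (n : ℕ) : ℝ := √t * (n : ℝ) ^ (-(((k : ℝ) + 1) / k))

variable {k : ℕ} {t : ℝ}

theorem scale_pos (ht : 0 < t) {n : ℕ} (hn : 0 < n) : 0 < scale k t n := by
  have : (0 : ℝ) < n := by exact_mod_cast hn
  rw [scale]; positivity

theorem scale_sq (ht : 0 < t) (n : ℕ) :
    scale k t n ^ 2 = t * (n : ℝ) ^ (-(2 * ((k : ℝ) + 1) / k)) := by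
  rw [scale, mul_pow, Real.sq_sqrt ht.le, ← Real.rpow_natCast, ← Real.rpow_mul (by positivity)]
  congr 2
  push_cast; ring

theorem tendsto_scale (hk : 0 < k) (ht : 0 < t) : Tendsto (scale k t) atTop (𝓝[>] 0) := by
  have hk' : (0 : ℝ) < k := by exact_mod_cast hk
  refine tendsto_nhdsWithin_iff.2 ⟨?_, ?_⟩
  · have := ((tendsto_rpow_neg_atTop (show 0 < ((k : ℝ) + 1) / k by positivity)).comp
      tendsto_natCast_atTop_atTop).const_mul √t
    rwa [mul_zero] at this
  · filter_upwards [eventually_gt_atTop 0] with n hn using scale_pos ht hn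

theorem natCast_mul_scale (hk : 0 < k) {n : ℕ} (hn : 0 < n) :
    n * scale k t n = √t * (n : ℝ) ^ (-(1 / (k : ℝ))) := by
  have hk' : (k : ℝ) ≠ 0 := by positivity
  have hn' : (0 : ℝ) < n := by exact_mod_cast hn
  have e : -(1 / (k : ℝ)) = 1 + -(((k : ℝ) + 1) / k) := by field_simp; ring
  rw [scale, e, Real.rpow_add hn', Real.rpow_one]
  ring

/-- This identity dictates the scale: the expected number of good tuples is of order n^(k+1) s^k and
must stay constant. -/
theorem pow_mul_scale_pow (hk : 0 < k) (ht : 0 < t) {n : ℕ} (hn : 0 < n) :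
    (n : ℝ) ^ (k + 1) * scale k t n ^ k = t ^ ((k : ℝ) / 2) := by
  have hk' : (k : ℝ) ≠ 0 := by positivity
  have hn' : (0 : ℝ) < n := by exact_mod_cast hn
  have e : (n : ℝ) ^ (k + 1) * scale k t n ^ k = n * (n * scale k t n) ^ k := by ring
  rw [e, natCast_mul_scale hk hn, mul_pow, ← Real.rpow_natCast ((n : ℝ) ^ _),
    ← Real.rpow_mul hn'.le, neg_mul, one_div_mul_cancel hk', Real.rpow_neg_one,
    Real.sqrt_eq_rpow, ← Real.rpow_natCast, ← Real.rpow_mul ht.le]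
  rw [show 1 / 2 * (k : ℝ) = k / 2 by ring]
  field_simp

theorem tendsto_natCast_rpow_neg (hk : 0 < k) :
    Tendsto (fun n : ℕ => (n : ℝ) ^ (-(1 / (k : ℝ)))) atTop (𝓝 0) := by
  have hk' : (0 : ℝ) < k := by exact_mod_cast hk
  exact (tendsto_rpow_neg_atTop (show 0 < 1 / (k : ℝ) by positivity)).comp
    tendsto_natCast_atTop_atTop

theorem tendsto_natCast_mul_scale (hk : 0 < k) (A : ℝ) :
    Tendsto (fun n : ℕ => n * (A * scale k t n)) atTop (𝓝 0) := by
  have := (tendsto_natCast_rpow_neg hk).const_mul (A * √t)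
  rw [mul_zero] at this
  refine this.congr' ?_
  filter_upwards [eventually_gt_atTop 0] with n hn
  rw [mul_left_comm, natCast_mul_scale hk hn]
  ring

/-- As n s = √t n^(-1/k), the error is a constant times n · n^(-(k+1)/k) = n^(-1/k). -/
theorem tendsto_overlap_error (hk : 0 < k) (A : ℝ) :
    Tendsto (fun n : ℕ => n * (n * (A * scale k t n)) ^ (k + 1)) atTop (𝓝 0) := by
  have := (tendsto_natCast_rpow_neg hk).const_mul ((A * √t) ^ (k + 1))
  rw [mul_zero] at this
  refine this.congr' ?_
  filter_upwards [eventually_gt_atTop 0] with n hn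
  have hk' : (k : ℝ) ≠ 0 := by positivity
  have hn' : (0 : ℝ) < n := by exact_mod_cast hn
  have e : ((n : ℝ) ^ (-(1 / (k : ℝ)))) ^ k * n = 1 := by
    rw [← Real.rpow_natCast, ← Real.rpow_mul hn'.le, neg_mul, one_div_mul_cancel hk',
      Real.rpow_neg_one, inv_mul_cancel₀ hn'.ne']
  rw [mul_left_comm, natCast_mul_scale hk hn]
  calc (A * √t) ^ (k + 1) * (n : ℝ) ^ (-(1 / (k : ℝ)))
      = (A * √t) ^ (k + 1) * (n : ℝ) ^ (-(1 / (k : ℝ))) *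
        (((n : ℝ) ^ (-(1 / (k : ℝ)))) ^ k * n) := by rw [e, mul_one]
    _ = _ := by ring

theorem tendsto_choose_div_pow (m : ℕ) :
    Tendsto (fun n : ℕ => (n.choose m : ℝ) / (n : ℝ) ^ m) atTop (𝓝 (1 / (m.factorial : ℝ))) := by
  have h := isEquivalent_choose m
  have h2 := ((Asymptotics.isEquivalent_iff_tendsto_one (by
    filter_upwards [eventually_gt_atTop 0] with n hn
    have : (0 : ℝ) < n := by exact_mod_cast hn
    positivity)).1 h).mul_const (1 / (m.factorial : ℝ))
  rw [one_mul] at h2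
  refine h2.congr' ?_
  filter_upwards [eventually_gt_atTop 0] with n hn
  have : (n : ℝ) ≠ 0 := by positivity
  have hf : (m.factorial : ℝ) ≠ 0 := by positivity
  simp only [Pi.div_apply]
  field_simp

end Scaling

/-! ### Passage to the limit -/

section Limit

variable {Ω : Type*} [MeasurableSpace Ω] {μ : Measure Ω} [IsProbabilityMeasure μ]
variable {U : ℕ → Ω → Circle} {g p : ℝ → ℝ} {k : ℕ} {t : ℝ}

/-- The expected number of `m`-tuples with a small deficit converges. -/
theorem tendsto_expected_number (hk : 0 < k) (hg : IsAdmissible g (k + 1))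
    (hG : (matrixG g (k + 1)).det ≠ 0) (hp : IsContinuousCircleDensity p) (ht : 0 < t) :
    Tendsto (fun n : ℕ => (n.choose (k + 1) : ℝ) *
      (Measure.pi fun _ : Fin (k + 1) => circleLaw p).real
        {u | maxValue g (k + 1) - pairKernel g u ≤ scale k t n ^ 2}) atTop
      (𝓝 (t ^ ((k : ℝ) / 2) * constK g p (k + 1) / (k + 1))) := by
  have h1 := (tendsto_deficit_probability hk hg hG hp).comp (tendsto_scale hk ht)
  have h2 := ((tendsto_choose_div_pow (k + 1)).mul h1).mul_const (t ^ ((k : ℝ) / 2))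
  -- The quotient k!/(k + 1)! of orderings and subsets produces the division by m.
  have e : 1 / (((k + 1).factorial : ℕ) : ℝ) * ((k.factorial : ℝ) * constK g p (k + 1)) *
      t ^ ((k : ℝ) / 2) = t ^ ((k : ℝ) / 2) * constK g p (k + 1) / (k + 1) := by
    have hf : (k.factorial : ℝ) ≠ 0 := by positivity
    have hk1 : (k : ℝ) + 1 ≠ 0 := by positivity
    rw [Nat.factorial_succ]
    push_cast
    field_simp
  rw [e] at h2
  refine h2.congr' ?_
  filter_upwards [eventually_gt_atTop 0] with n hn
  have hn' : (0 : ℝ) < n := by exact_mod_cast hn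
  have hs := scale_pos (k := k) ht hn
  rw [← pow_mul_scale_pow hk ht hn, Function.comp_apply]
  field_simp

theorem tendsto_prob_no_tuple (hk : 0 < k) (hg : IsAdmissible g (k + 1))
    (hG : (matrixG g (k + 1)).det ≠ 0) (hp : IsContinuousCircleDensity p) (ht : 0 < t)
    (hU : ∀ i, Measurable (U i)) (hind : iIndepFun U μ)
    (hlaw : ∀ i, μ.map (U i) = circleLaw p) :
    Tendsto (fun n : ℕ => μ.real {ω | ∑ J ∈ Finset.powersetCard (k + 1) (Finset.range n),
        tupleIndicator U g k (scale k t n ^ 2) J ω = 0}) atTop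
      (𝓝 (exp (-(t ^ ((k : ℝ) / 2) * constK g p (k + 1) / (k + 1))))) := by
  obtain ⟨c, hc, hgrow⟩ := exists_growth hg hG
  obtain ⟨P, hP0, hP⟩ := hp.exists_bound
  -- The bound of `circleLaw_nearRegular_le` for δ = 2√(s²/c) equals A s.
  set A : ℝ := (3 * ((k + 1 : ℕ) : ℝ) + 1) * P * (2 * (2 * √(1 / c))) with hA
  have hexp := (continuous_exp.tendsto _).comp (tendsto_expected_number hk hg hG hp ht).neg
  have herr := (tendsto_overlap_error (t := t) hk A).const_mul
    (2 * (4 ^ (2 * (k + 1)) * (2 * ((k : ℝ) + 1) + 1)))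
  rw [mul_zero] at herr
  have hdiff := squeeze_zero_norm' (f := fun n : ℕ =>
    μ.real {ω | ∑ J ∈ Finset.powersetCard (k + 1) (Finset.range n),
        tupleIndicator U g k (scale k t n ^ 2) J ω = 0} -
      exp (-((n.choose (k + 1) : ℝ) * (Measure.pi fun _ : Fin (k + 1) => circleLaw p).real
        {u | maxValue g (k + 1) - pairKernel g u ≤ scale k t n ^ 2}))) (by
    filter_upwards [eventually_gt_atTop 0,
      (tendsto_natCast_mul_scale (t := t) hk A).eventually (ge_mem_nhds one_pos)] with n hn hn1
    have hs := scale_pos (k := k) ht hn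
    refine abs_prob_sub_exp_le hk hU hind hlaw hp hg.cont hc hgrow (κ := A * scale k t n)
      (by positivity) (fun z => ?_) hn hn1
    refine (circleLaw_nearRegular_le hp hP0.le hP _ _ z).trans (le_of_eq ?_)
    rw [div_eq_mul_one_div, Real.sqrt_mul (by positivity), Real.sqrt_sq hs.le, hA]
    congr 1
    ring) herr
  have := hdiff.add hexp
  rw [zero_add] at this
  refine this.congr fun n => ?_
  simp only [Function.comp_apply, sub_add_cancel]

end Limit

end UMax

theorem corollary6p1
    (m : ℕ) (hm : 2 ≤ m)
    (g : ℝ → ℝ)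
    (hg_cont : ContinuousOn g (Icc 0 (2 * π)))
    (hg_conc : StrictConcaveOn ℝ (Icc 0 (2 * π)) g)
    (hg_smooth : ∀ s ∈ Finset.Icc 1 (m - 1), ContDiffAt ℝ 3 g (2 * π * (s : ℝ) / (m : ℝ)))
    (hg_symm : ∀ x ∈ Icc 0 (2 * π), g x = g (2 * π - x))
    (hG : (UMax.matrixG g m).det ≠ 0)
    (p : ℝ → ℝ) (hp : UMax.IsContinuousCircleDensity p)
    (hp_pos : 0 < UMax.densityIntegral p m)
    {Ω : Type*} [MeasurableSpace Ω] (μ : Measure Ω) [IsProbabilityMeasure μ]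
    (U : ℕ → Ω → Circle) (hU_meas : ∀ i, Measurable (U i))
    (hU_indep : iIndepFun U μ)
    (hU_law : ∀ i, μ.map (U i) = UMax.circleLaw p)
    (t : ℝ) (ht : 0 < t) :
    Tendsto
      (fun n : ℕ => μ.real {ω |
        (n : ℝ) ^ (2 * (m : ℝ) / ((m : ℝ) - 1)) *
          (UMax.maxValue g m - UMax.uMax (UMax.pairKernel g (m := m)) n (fun i => U i ω)) ≤ t})
      atTop
      (𝓝 (1 - Real.exp (-(t ^ (((m : ℝ) - 1) / 2) * UMax.constK g p m / (m : ℝ))))) := by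
  obtain ⟨k, rfl⟩ : ∃ k, m = k + 1 := ⟨m - 1, by omega⟩
  have hk : 0 < k := by omega
  have hg : UMax.IsAdmissible g (k + 1) :=
    ⟨hg_cont, hg_conc.concaveOn, fun s hs => (hg_smooth s hs).of_le (by norm_num), hg_symm⟩
  -- For n ≥ m the event of the theorem is the complement of the event that no tuple has deficit at
  -- most the squared scale.
  have hmain := (UMax.tendsto_prob_no_tuple hk hg hG hp ht hU_meas hU_indep hU_law).const_sub 1
  push_cast
  simp only [add_sub_cancel_right]
  refine hmain.congr' ?_
  filter_upwards [eventually_ge_atTop (k + 1)] with n hn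
  have hn0 : 0 < n := by omega
  have hn' : (0 : ℝ) < n := by exact_mod_cast hn0
  set T := Finset.powersetCard (k + 1) (Finset.range n)
  set ε := UMax.scale k t n ^ 2 with hε
  have hmeas : MeasurableSet {ω | ∑ J ∈ T, UMax.tupleIndicator U g k ε J ω = 0} :=
    (Finset.measurable_sum T fun J _ => UMax.measurable_tupleIndicator hU_meas hg_cont ε J)
      (measurableSet_singleton 0)
  rw [← probReal_compl_eq_one_sub hmeas]
  congr 1
  ext ω
  have hpow : (n : ℝ) ^ (2 * ((k : ℝ) + 1) / k) *
      (UMax.maxValue g (k + 1) - UMax.uMax (UMax.pairKernel g (m := k + 1)) n (fun i => U i ω)) ≤ t ↔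
      UMax.maxValue g (k + 1) -
        UMax.uMax (UMax.pairKernel g (m := k + 1)) n (fun i => U i ω) ≤ ε := by
    rw [hε, UMax.scale_sq ht, Real.rpow_neg hn'.le, ← div_eq_mul_inv, le_div_iff₀' (by positivity)]
  rw [mem_ofPred_eq, hpow, UMax.uMax_deficit_le_iff g ε hn, mem_compl_iff, mem_ofPred_eq,
    Finset.sum_eq_zero_iff]
  push Not
  refine exists_congr fun J => and_congr_right fun _ => ?_
  rw [UMax.tupleIndicator, indicator_apply_ne_zero]
  simp
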